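/- Let $n\ge 1$, $1\le p<\infty$, $0<\theta\le\infty$. Functions on $\mathbb R^n$ are extended real-valued and Lebesgue measurable, and $0\cdot\infty=0$, $1/\infty=0$. For a nonnegative measurable $w$ and a measurable set $A$ put $\|f\|_{q,w,A}=\left(\int_A|f|^q w\,dx\right)^{1/q}$ if $q<\infty$ and $\|f\|_{\infty,w,A}=\operatorname{ess\,sup}_{A}|f|w$; the weight is omitted when $w\equiv1$. Let $v$ be a weight on $\mathbb R^n$, i.e. measurable, positive and finite a.e., and let $\omega\ge0$ be measurable on $(0,\infty)$ with $0<\|\omega\|_{\theta,(t,\infty)}<\infty$ for every $t>0$. Let $X=LM_{p\theta,\omega}(\mathbb R^n,v)$ be the weighted local Morrey-type space of all $f$ with $\|f\|_{p,v,K}<\infty$ for every compact $K$ and $$\|f\|_X=\Big\|\,\omega(r)\,\|f\|_{p,v,B(0,r)}\Big\|_{\theta,(0,\infty)}<\infty ,$$ where $B(0,r)$ is the open ball, and let ${}^{c}B(0,r)=\mathbb R^n\setminus B(0,r)$. The associate norm is $$\|f\|_{X'}=\sup\Big\{\int_{\mathbb R^n}|f(x)g(x)|\,dx:\ g\in X,\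 \|g\|_X\le1\Big\}.$$ Let $1/p+1/p'=1$ and $1/\theta+1/\theta'=1$ (the latter for $\theta>1$), with $1'=\infty$ and $\infty'=1$. If $p=1$, the symbol $v^{1-p'}$ is read as $v^{-1}$, so that $\|f\|_{p',v^{1-p'},A}=\operatorname{ess\,sup}_A |f|/v$. For nonnegative $A,B$ (possibly $+\infty$), $A\approx B$ means $c\,A\le B\le C\,A$ with constants $0<c,C<\infty$ independent of $f$. (i) If $0<\theta\le1$, then for all measurable $f$ $$\|f\|_{X'}\approx\sup_{t>0}\ \|f\|_{p',v^{1-p'},{}^{c}B(0,t)}\ \|\omega\|_{\theta,(t,\infty)}^{-1}.$$ (ii) If $1<\theta\le\infty$, then for all measurable $f$ $$\|f\|_{X'}\approx\left(\int_{(0,\infty)}\|f\|_{p',v^{1-p'},{}^{c}B(0,t)}^{\theta'}\,d\Big(\|\omega\|_{\theta,(t-,\infty)}^{-\theta'}\Big)\right)^{1/\theta'}+\frac{\|f\|_{p',v^{1-p'},\mathbb R^n}}{\|\omega\|_{\theta,(0,\infty)}} ,$$ where $\|\omega\|_{\theta,(t-,\infty)}=\lim_{s\to t-}\|\omega\|_{\theta,(s,\infty)}$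 and the integral is the Lebesgue–Stieltjes integral with respect to the Borel measure $\lambda$ on $(0,\infty)$ with $\lambda([y,z])=\varphi(z+)-\varphi(y-)$ for $0<y\le z<\infty$, $\varphi(t)=\|\omega\|_{\theta,(t-,\infty)}^{-\theta'}$. The quotient is $0$ if $\|\omega\|_{\theta,(0,\infty)}=\infty$. -/

import Mathlib

open MeasureTheory Set
open scoped ENNReal NNReal

namespace WeightedMorrey

noncomputable section

/-- The Euclidean space `ℝⁿ`. -/
abbrev RSpace (n : ℕ) : Type := EuclideanSpace ℝ (Fin n)

/-- The functional `‖φ‖_{p,A,w}`: it is `(∫_A φ^p w)^{1/p}` for `p < ∞` and `ess sup_A φ w` for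
`p = ∞`. Here `φ` is `[0,∞]`-valued; a signed function enters through its modulus. -/
def wNorm {α : Type*} [MeasureSpace α] (p : ℝ≥0∞) (w : α → ℝ≥0∞) (A : Set α)
    (φ : α → ℝ≥0∞) : ℝ≥0∞ :=
  if p = ∞ then essSup (fun x => φ x * w x) (volume.restrict A)
  else (∫⁻ x in A, φ x ^ p.toReal * w x) ^ (1 / p.toReal)

/-- Weights on `ℝⁿ`: (Lebesgue) measurable functions, positive and finite almost everywhere. -/
def IsWeight {n : ℕ} (v : RSpace n → ℝ≥0∞) : Prop :=
  AEMeasurable v ∧ ∀ᵐ x, 0 < v x ∧ v x < ∞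

/-- `‖ω‖_{θ,(t,∞)}` for `t ≥ 0`; for `t < 0` the interval is `(0,∞)`. -/
def tailNorm (θ : ℝ≥0∞) (ω : ℝ → ℝ≥0∞) (t : ℝ) : ℝ≥0∞ :=
  wNorm θ 1 (Ioi (max t 0)) ω

/-- The class `Ω_θ`: nonnegative measurable `ω` on `(0,∞)` (values off `(0,∞)` are never used)
with `0 < ‖ω‖_{θ,(t,∞)} < ∞` for all `t > 0`. -/
def OmegaClass (θ : ℝ≥0∞) (ω : ℝ → ℝ≥0∞) : Prop :=
  AEMeasurable ω (volume.restrict (Ioi 0)) ∧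
    ∀ t : ℝ, 0 < t → 0 < tailNorm θ ω t ∧ tailNorm θ ω t < ∞

/-- The functional `‖f‖ = ‖ ω(r) ‖f‖_{p,v,B(0,r)} ‖_{θ,(0,∞)}`. -/
def morreyNorm {n : ℕ} (p θ : ℝ≥0∞) (ω : ℝ → ℝ≥0∞) (v : RSpace n → ℝ≥0∞)
    (f : RSpace n → EReal) : ℝ≥0∞ :=
  wNorm θ 1 (Ioi (0 : ℝ)) fun r => ω r * wNorm p v (Metric.ball 0 r) fun x => (f x).abs

/-- The weighted local Morrey-type space `LM_{pθ,ω}(ℝⁿ,v)`: measurable `f`, locally in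
`L_p(v)`, with finite Morrey norm. -/
def LocalMorrey (n : ℕ) (p θ : ℝ≥0∞) (ω : ℝ → ℝ≥0∞) (v : RSpace n → ℝ≥0∞) :
    Set (RSpace n → EReal) :=
  {f | AEMeasurable f ∧ (∀ K : Set (RSpace n), IsCompact K → wNorm p v K (fun x => (f x).abs) < ∞) ∧
    morreyNorm p θ ω v f < ∞}

/-- The associate (Köthe dual) norm of a set `X` of functions with functional `N`:
`‖f‖_{X'} = sup { ∫ |f g| : g ∈ X, N g ≤ 1 }`. -/
def associateNorm {n : ℕ} (X : Set (RSpace n → EReal)) (N : (RSpace n → EReal) → ℝ≥0∞)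
    (f : RSpace n → EReal) : ℝ≥0∞ :=
  ⨆ g : RSpace n → EReal, ⨆ _ : g ∈ X ∧ N g ≤ 1, ∫⁻ x, (f x * g x).abs

/-- The weight `v^{1-p'}` accompanying the exponent `p'`; for `p = 1` (`p' = ∞`) it is `v⁻¹`. -/
def dualWeight {n : ℕ} (p : ℝ≥0∞) (v : RSpace n → ℝ≥0∞) : RSpace n → ℝ≥0∞ := fun x =>
  if p = 1 then (v x)⁻¹ else v x ^ (1 - p.conjExponent.toReal)

/-- `‖f‖_{p',v^{1-p'},A}`. -/
def dualNorm {n : ℕ} (p : ℝ≥0∞) (v : RSpace n → ℝ≥0∞) (A : Set (RSpace n))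
    (f : RSpace n → EReal) : ℝ≥0∞ :=
  wNorm p.conjExponent (dualWeight p v) A fun x => (f x).abs

/-- The function `t ↦ ‖ω‖_{θ,(t-,∞)}^{-θ'}`, whose Lebesgue-Stieltjes measure is needed on
`(0,∞)`. -/
def stieltjesWeight (θ : ℝ≥0∞) (ω : ℝ → ℝ≥0∞) (t : ℝ) : ℝ :=
  (Function.leftLim (tailNorm θ ω) t ^ (-θ.conjExponent.toReal)).toReal

theorem tailNorm_antitone (θ : ℝ≥0∞) (ω : ℝ → ℝ≥0∞) : Antitone (tailNorm θ ω) := by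
  intro s t hst
  have hsub : Ioi (max t 0) ⊆ Ioi (max s 0) := Ioi_subset_Ioi (max_le_max_right 0 hst)
  unfold tailNorm wNorm
  split_ifs
  · exact essSup_mono_measure' (Measure.restrict_mono_set _ hsub)
  · exact ENNReal.rpow_le_rpow (lintegral_mono_set hsub) (by positivity)

theorem stieltjesWeight_monotone {θ : ℝ≥0∞} {ω : ℝ → ℝ≥0∞} (hω : OmegaClass θ ω) :
    Monotone (stieltjesWeight θ ω) := by
  intro s t hst
  have hpos : ∀ t, 0 < Function.leftLim (tailNorm θ ω) t := fun t =>
    (hω.2 (max t 1) (by positivity)).1.trans_le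
      ((tailNorm_antitone θ ω).le_leftLim (le_max_left t 1))
  unfold stieltjesWeight
  refine ENNReal.toReal_mono ?_ ?_
  · rw [ENNReal.rpow_neg]
    exact ENNReal.inv_ne_top.2 (ENNReal.rpow_pos_of_nonneg (hpos t) ENNReal.toReal_nonneg).ne'
  · rw [ENNReal.rpow_neg, ENNReal.rpow_neg, ENNReal.inv_le_inv]
    exact ENNReal.rpow_le_rpow ((tailNorm_antitone θ ω).leftLim hst) ENNReal.toReal_nonneg

/-- The Lebesgue-Stieltjes measure `λ` of `φ(t) = ‖ω‖_{θ,(t-,∞)}^{-θ'}`, that is, the Borel measure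
with `λ([y,z]) = φ(z+) - φ(y-)`. -/
def stieltjesMeasure {θ : ℝ≥0∞} {ω : ℝ → ℝ≥0∞} (hω : OmegaClass θ ω) : Measure ℝ :=
  (stieltjesWeight_monotone hω).stieltjesFunction.measure

end

end WeightedMorrey

open WeightedMorrey

namespace WeightedMorrey

open Filter Topology

/-! Write T(t) = ‖ω‖_{θ,(t,∞)}, F(s) for the dual norm of f off B(0,s), and G(r) for the norm of g
on B(0,r). Let Λ be the measure on [0,∞) with Λ([0,s]) = T(s)^{-κ}, where κ = θ' if θ > 1 and κ = 1
if θ ≤ 1. For θ > 1 its restriction to (0,∞) is the Stieltjes measure λ. Its atom at 0 has mass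
‖ω‖_{θ,(0,∞)}^{-θ'}, so ∫ F^{θ'} dΛ contains both terms of (ii) at once.

Upper bound. Let ρ be the distribution of |x| under |fg| dx. Hölder's inequality on annuli gives
ρ([s,r)) ≤ F(s) G(r), and this is all that is used about f and g. If θ < ∞, put η = ω^θ dr, so that
η((u,∞)) = T(u)^θ. Powers of the distribution functions of Λ and η integrate to higher powers
(`rpow_measure_Iic_le`, `rpow_measure_Ioi_le`). With suitable exponents the product of the two
integrals, over s ≤ u and r > u, is bounded below uniformly in u. Integrating this against ρ and
using Tonelli (`measure_univ_le_of_kernel`) bounds the total mass of ρ by a double integral of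
ρ([s,r)) ≤ F(s) G(r) over s < r. Hölder finishes the case 1 < θ < ∞, and a pointwise bound finishes
θ ≤ 1. For θ = ∞ the level sets of T play the role of η.

Lower bound. A near-extremal g supported off B(0,t), scaled by 1/T(t), gives F(t)/T(t) ≤ ‖f‖_{X'},
which settles (i). For (ii), [0,∞) is cut up to a null set where T^{-θ'} is comparable to 2^j, with
s_j the infimum of the j-th piece. Then ∫ F^{θ'} dΛ is at most 2 ∑ F(s_j)^{θ'} 2^j. By ℓ^{θ'}–ℓ^θ
duality this sum is tested on superpositions of near-extremal functions off B(0,s_j); geometric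
decay of T(s_k) 2^{j/θ'} in k - j keeps their Morrey norm bounded. -/

/-! ### Tail norms of ω and the measures generated by their negative powers -/

theorem wNorm_top {α : Type*} [MeasureSpace α] (w : α → ℝ≥0∞) (A : Set α) (φ : α → ℝ≥0∞) :
    wNorm ∞ w A φ = essSup (fun x => φ x * w x) (volume.restrict A) := if_pos rfl

theorem wNorm_of_ne_top {α : Type*} [MeasureSpace α] {p : ℝ≥0∞} (hp : p ≠ ∞) (w : α → ℝ≥0∞)
    (A : Set α) (φ : α → ℝ≥0∞) :
    wNorm p w A φ = (∫⁻ x in A, φ x ^ p.toReal * w x) ^ (p.toReal)⁻¹ := by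
  rw [wNorm, if_neg hp, one_div]

theorem wNorm_mono_set {α : Type*} [MeasureSpace α] (p : ℝ≥0∞) (w : α → ℝ≥0∞) {A B : Set α}
    (h : A ⊆ B) (φ : α → ℝ≥0∞) : wNorm p w A φ ≤ wNorm p w B φ := by
  unfold wNorm
  split_ifs
  · exact essSup_mono_measure' (Measure.restrict_mono_set _ h)
  · exact ENNReal.rpow_le_rpow (lintegral_mono_set h) (by positivity)

theorem tailNorm_zero (θ : ℝ≥0∞) (ω : ℝ → ℝ≥0∞) : tailNorm θ ω 0 = wNorm θ 1 (Ioi 0) ω := by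
  simp [tailNorm]

theorem OmegaClass.pos {θ : ℝ≥0∞} {ω : ℝ → ℝ≥0∞} (hω : OmegaClass θ ω) (t : ℝ) :
    0 < tailNorm θ ω t :=
  (hω.2 (max t 1) (by positivity)).1.trans_le (tailNorm_antitone θ ω (le_max_left t 1))

theorem OmegaClass.lt_top {θ : ℝ≥0∞} {ω : ℝ → ℝ≥0∞} (hω : OmegaClass θ ω) {t : ℝ} (ht : 0 < t) :
    tailNorm θ ω t < ∞ := (hω.2 t ht).2

theorem Ioi_eq_iUnion_add_inv (a : ℝ) : Ioi a = ⋃ n : ℕ, Ioi (a + 1 / ((n : ℝ) + 1)) := by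
  ext x
  simp only [mem_Ioi, mem_iUnion]
  refine ⟨fun h => ?_, fun ⟨n, hn⟩ => lt_trans (by simp; positivity) hn⟩
  obtain ⟨n, hn⟩ := exists_nat_one_div_lt (sub_pos.2 h)
  exact ⟨n, by linarith⟩

/-- The open half-line is a countable increasing union of smaller ones, so monotone convergence (or
countably many a.e. bounds if θ = ∞) applies. This is the right continuity of the tail norm. -/
theorem tailNorm_le_of_forall_gt {θ : ℝ≥0∞} (hθ : 0 < θ) (ω : ℝ → ℝ≥0∞) (t : ℝ) {S : ℝ≥0∞}
    (hS : ∀ s, t < s → tailNorm θ ω s ≤ S) : tailNorm θ ω t ≤ S := by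
  set a := max t 0 with ha
  have hb : ∀ n : ℕ, wNorm θ 1 (Ioi (a + 1 / ((n : ℝ) + 1))) ω ≤ S := fun n => by
    have hpos : (0 : ℝ) < 1 / ((n : ℝ) + 1) := by positivity
    have h0 : 0 ≤ a := le_max_right _ _
    have h := hS (a + 1 / ((n : ℝ) + 1)) (by linarith [le_max_left t 0])
    rwa [tailNorm, max_eq_left (by linarith)] at h
  change wNorm θ 1 (Ioi a) ω ≤ S
  by_cases hθ' : θ = ∞
  · subst hθ'
    rw [wNorm_top]
    refine essSup_le_of_ae_le _ ?_
    rw [Ioi_eq_iUnion_add_inv a]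
    refine (ae_restrict_iUnion_iff _ _).2 fun n => ?_
    have h := hb n
    rw [wNorm_top] at h
    filter_upwards [ENNReal.ae_le_essSup (μ := volume.restrict (Ioi (a + 1 / ((n : ℝ) + 1))))
      (fun x => ω x * (1 : ℝ → ℝ≥0∞) x)] with x hx using hx.trans h
  · have hpos : 0 < θ.toReal := ENNReal.toReal_pos hθ.ne' hθ'
    simp only [wNorm_of_ne_top hθ', ENNReal.rpow_inv_le_iff hpos] at hb ⊢
    simp only [← withDensity_apply _ measurableSet_Ioi] at hb ⊢
    rw [Ioi_eq_iUnion_add_inv a, Monotone.measure_iUnion]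
    · exact iSup_le hb
    · intro m n hmn
      refine Ioi_subset_Ioi ?_
      have := one_div_le_one_div_of_le (by positivity : (0 : ℝ) < m + 1)
        (by exact_mod_cast Nat.succ_le_succ hmn : (m : ℝ) + 1 ≤ n + 1)
      linarith

theorem tailNorm_tendsto_nhdsGT {θ : ℝ≥0∞} (hθ : 0 < θ) (ω : ℝ → ℝ≥0∞) (t : ℝ) :
    Tendsto (tailNorm θ ω) (𝓝[>] t) (𝓝 (tailNorm θ ω t)) := by
  have h := (tailNorm_antitone θ ω).tendsto_nhdsGT t
  have : sSup (tailNorm θ ω '' Ioi t) = tailNorm θ ω t := by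
    refine le_antisymm (sSup_le ?_) (tailNorm_le_of_forall_gt hθ ω t fun s hs =>
      le_sSup (mem_image_of_mem _ hs))
    rintro _ ⟨s, hs, rfl⟩
    exact tailNorm_antitone θ ω (le_of_lt hs)
  rwa [this] at h

theorem OmegaClass.rpow_neg_ne_top {θ : ℝ≥0∞} {ω : ℝ → ℝ≥0∞} (hω : OmegaClass θ ω) {κ : ℝ}
    (hκ : 0 < κ) (t : ℝ) : tailNorm θ ω t ^ (-κ) ≠ ∞ := by
  simp [ENNReal.rpow_eq_top_iff, (hω.pos t).ne', hκ.le]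

/-- The right-continuous function `t ↦ ‖ω‖_{θ,(t,∞)}^{-κ}`. -/
noncomputable def tailStieltjes {θ : ℝ≥0∞} (hθ : 0 < θ) {ω : ℝ → ℝ≥0∞} (hω : OmegaClass θ ω)
    {κ : ℝ} (hκ : 0 < κ) : StieltjesFunction ℝ where
  toFun t := (tailNorm θ ω t ^ (-κ)).toReal
  mono' := fun s t hst => by
    refine ENNReal.toReal_mono (hω.rpow_neg_ne_top hκ t) ?_
    rw [ENNReal.rpow_neg, ENNReal.rpow_neg, ENNReal.inv_le_inv]
    exact ENNReal.rpow_le_rpow (tailNorm_antitone θ ω hst) hκ.le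
  right_continuous' := fun t => by
    rw [← continuousWithinAt_Ioi_iff_Ici]
    refine (ENNReal.tendsto_toReal (hω.rpow_neg_ne_top hκ t)).comp ?_
    exact (ENNReal.continuous_rpow_const.tendsto _).comp (tailNorm_tendsto_nhdsGT hθ ω t)

theorem ofReal_tailStieltjes {θ : ℝ≥0∞} (hθ : 0 < θ) {ω : ℝ → ℝ≥0∞} (hω : OmegaClass θ ω)
    {κ : ℝ} (hκ : 0 < κ) (t : ℝ) :
    ENNReal.ofReal (tailStieltjes hθ hω hκ t) = tailNorm θ ω t ^ (-κ) :=
  ENNReal.ofReal_toReal (hω.rpow_neg_ne_top hκ t)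

/-- Since T is monotone, φ(t) ≤ T(t)^{-θ'} ≤ φ(t') for t < t'. As T is right continuous, the right
limit of φ is T^{-θ'} itself, so the left limits in φ do not affect the measure. -/
theorem stieltjesMeasure_eq {θ : ℝ≥0∞} (hθ : 0 < θ) {ω : ℝ → ℝ≥0∞} (hω : OmegaClass θ ω)
    (hκ : 0 < θ.conjExponent.toReal) : stieltjesMeasure hω = (tailStieltjes hθ hω hκ).measure := by
  have hpos : ∀ t, 0 < Function.leftLim (tailNorm θ ω) t := fun t =>
    (hω.pos t).trans_le ((tailNorm_antitone θ ω).le_leftLim le_rfl)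
  have key : (stieltjesWeight_monotone hω).stieltjesFunction = tailStieltjes hθ hω hκ := by
    ext x
    rw [Monotone.stieltjesFunction_eq]
    set L := tailStieltjes hθ hω hκ with hL
    have hL' : ∀ t, L t = (tailNorm θ ω t ^ (-θ.conjExponent.toReal)).toReal := fun t => rfl
    have hle : ∀ t, stieltjesWeight θ ω t ≤ L t := fun t => by
      rw [hL']
      refine ENNReal.toReal_mono (hω.rpow_neg_ne_top hκ t) ?_
      rw [ENNReal.rpow_neg, ENNReal.rpow_neg, ENNReal.inv_le_inv]
      exact ENNReal.rpow_le_rpow ((tailNorm_antitone θ ω).le_leftLim le_rfl) hκ.le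
    have hge : ∀ s t, s < t → L s ≤ stieltjesWeight θ ω t := fun s t hst => by
      rw [hL']
      refine ENNReal.toReal_mono ?_ ?_
      · simp [ENNReal.rpow_eq_top_iff, (hpos t).ne', hκ.le]
      · rw [ENNReal.rpow_neg, ENNReal.rpow_neg, ENNReal.inv_le_inv]
        exact ENNReal.rpow_le_rpow ((tailNorm_antitone θ ω).leftLim_le hst) hκ.le
    have h1 := (stieltjesWeight_monotone hω).tendsto_rightLim x
    have h2 : Tendsto L (𝓝[>] x) (𝓝 (L x)) :=
      (L.right_continuous x).tendsto.mono_left (nhdsWithin_mono _ Ioi_subset_Ici_self)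
    refine le_antisymm (le_of_tendsto_of_tendsto' h1 h2 hle) ?_
    refine ge_of_tendsto h1 ?_
    filter_upwards [self_mem_nhdsWithin] with t ht using hge x t ht
  rw [stieltjesMeasure, key]

/-- The measure on `[0,∞)` with distribution function `t ↦ ‖ω‖_{θ,(t,∞)}^{-κ}`. -/
noncomputable def tailMeasure {θ : ℝ≥0∞} (hθ : 0 < θ) {ω : ℝ → ℝ≥0∞} (hω : OmegaClass θ ω)
    {κ : ℝ} (hκ : 0 < κ) : Measure ℝ :=
  (tailStieltjes hθ hω hκ).measure.restrict (Ioi 0)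
    + (tailNorm θ ω 0 ^ (-κ)) • Measure.dirac 0

theorem tailMeasure_Iic {θ : ℝ≥0∞} (hθ : 0 < θ) {ω : ℝ → ℝ≥0∞} (hω : OmegaClass θ ω)
    {κ : ℝ} (hκ : 0 < κ) {s : ℝ} (hs : 0 ≤ s) :
    tailMeasure hθ hω hκ (Iic s) = tailNorm θ ω s ^ (-κ) := by
  rw [tailMeasure, Measure.add_apply, Measure.restrict_apply measurableSet_Iic, inter_comm,
    Ioi_inter_Iic, StieltjesFunction.measure_Ioc, Measure.smul_apply,
    Measure.dirac_apply' _ measurableSet_Iic, indicator_of_mem (by exact hs)]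
  have h0 : 0 ≤ tailStieltjes hθ hω hκ 0 := ENNReal.toReal_nonneg
  rw [← ofReal_tailStieltjes hθ hω hκ 0, ← ofReal_tailStieltjes hθ hω hκ s, Pi.one_apply,
    smul_eq_mul, mul_one,
    ← ENNReal.ofReal_add (sub_nonneg.2 ((tailStieltjes hθ hω hκ).mono hs)) h0, sub_add_cancel]

theorem tailMeasure_Iio_zero {θ : ℝ≥0∞} (hθ : 0 < θ) {ω : ℝ → ℝ≥0∞} (hω : OmegaClass θ ω)
    {κ : ℝ} (hκ : 0 < κ) : tailMeasure hθ hω hκ (Iio 0) = 0 := by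
  rw [tailMeasure, Measure.add_apply, Measure.restrict_apply measurableSet_Iio, Measure.smul_apply,
    Measure.dirac_apply' _ measurableSet_Iio]
  have : Iio (0 : ℝ) ∩ Ioi 0 = ∅ := by
    ext x
    simp only [mem_inter_iff, mem_Iio, mem_Ioi, mem_empty_iff_false, iff_false]
    exact fun h => lt_asymm h.1 h.2
  simp [this]

instance {θ : ℝ≥0∞} (hθ : 0 < θ) {ω : ℝ → ℝ≥0∞} (hω : OmegaClass θ ω) {κ : ℝ} (hκ : 0 < κ) :
    SFinite (tailMeasure hθ hω hκ) := by
  unfold tailMeasure; infer_instance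

theorem lintegral_tailMeasure {θ : ℝ≥0∞} (hθ : 0 < θ) {ω : ℝ → ℝ≥0∞} (hω : OmegaClass θ ω)
    {κ : ℝ} (hκ : 0 < κ) {φ : ℝ → ℝ≥0∞} (hφ : Measurable φ) :
    ∫⁻ t, φ t ∂(tailMeasure hθ hω hκ) =
      ∫⁻ t in Ioi 0, φ t ∂(tailStieltjes hθ hω hκ).measure + tailNorm θ ω 0 ^ (-κ) * φ 0 := by
  rw [tailMeasure, lintegral_add_measure, lintegral_smul_measure, lintegral_dirac' _ hφ, smul_eq_mul]

/-! ### Integrals of powers of distribution functions, and a Tonelli principle -/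

/-- The set is closed downwards. If it has a largest element e it lies in `Iic e`; otherwise it is
covered by a directed countable family of half-lines with rational endpoints in the set. -/
theorem measure_setOf_measure_Iic_lt_le (m : Measure ℝ) (y : ℝ≥0∞) :
    m {s | m (Iic s) < y} ≤ y := by
  set E := {s | m (Iic s) < y}
  by_cases h : ∃ e ∈ E, ∀ s ∈ E, s ≤ e
  · obtain ⟨e, he, hmax⟩ := h
    exact (measure_mono (fun s hs => hmax s hs)).trans (le_of_lt he)
  · push Not at h
    have hsub : E ⊆ ⋃ q ∈ {q : ℚ | (q : ℝ) ∈ E}, Iic (q : ℝ) := fun s hs => by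
      obtain ⟨e, he, hse⟩ := h s hs
      obtain ⟨q, hq1, hq2⟩ := exists_rat_btwn hse
      exact mem_biUnion (lt_of_le_of_lt (measure_mono (Iic_subset_Iic.2 hq2.le)) he) hq1.le
    refine (measure_mono hsub).trans ?_
    rw [measure_biUnion_eq_iSup (to_countable _)]
    · exact iSup₂_le fun q hq => le_of_lt hq
    · intro a ha b hb
      rcases le_total a b with hab | hab
      · exact ⟨b, hb, Iic_subset_Iic.2 (Rat.cast_le.2 hab), subset_rfl⟩
      · exact ⟨a, ha, subset_rfl, Iic_subset_Iic.2 (Rat.cast_le.2 hab)⟩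

theorem measurable_measure_Iic (m : Measure ℝ) : Measurable fun s => m (Iic s) :=
  Monotone.measurable fun _ _ h => measure_mono (Iic_subset_Iic.2 h)

theorem measurable_measure_Ioi (m : Measure ℝ) : Measurable fun s => m (Ioi s) :=
  Antitone.measurable fun _ _ h => measure_mono (Ioi_subset_Ioi h)

/-- A substitute for ∫ Φ^B dΦ = Φ^{B+1}/(B+1) that tolerates atoms: at most half of the mass of `Iic
u` sits where the distribution function is below half its final value, so at least half sits where
it is above. -/
theorem rpow_measure_Iic_le (m : Measure ℝ) {u : ℝ} (hu : m (Iic u) ≠ ∞) {B : ℝ} (hB : 0 ≤ B) :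
    m (Iic u) ^ (B + 1) ≤ 2 ^ (B + 1) * ∫⁻ s in Iic u, m (Iic s) ^ B ∂m := by
  set c := m (Iic u) with hc
  set S := Iic u ∩ {s | c / 2 ≤ m (Iic s)} with hS
  have hSm : MeasurableSet S :=
    measurableSet_Iic.inter (measurableSet_le measurable_const (measurable_measure_Iic m))
  have h1 : c / 2 ≤ m S := by
    have h2 : c ≤ m S + c / 2 := by
      calc c ≤ m (S ∪ {s | m (Iic s) < c / 2}) := by
            refine measure_mono fun s hs => ?_
            by_cases h : c / 2 ≤ m (Iic s)
            · exact Or.inl ⟨hs, h⟩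
            · exact Or.inr (not_le.1 h)
        _ ≤ m S + m {s | m (Iic s) < c / 2} := measure_union_le _ _
        _ ≤ m S + c / 2 := by gcongr; exact measure_setOf_measure_Iic_lt_le m _
    have h3 : c / 2 + c / 2 ≤ m S + c / 2 := by rwa [ENNReal.add_halves]
    exact (ENNReal.add_le_add_iff_right (ENNReal.div_ne_top hu (by norm_num))).1 h3
  have h4 : (c / 2) ^ (B + 1) ≤ ∫⁻ s in Iic u, m (Iic s) ^ B ∂m := by
    calc (c / 2) ^ (B + 1) = (c / 2) ^ B * (c / 2) := by
          rw [ENNReal.rpow_add_of_nonneg _ _ hB zero_le_one, ENNReal.rpow_one]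
      _ ≤ (c / 2) ^ B * m S := by gcongr
      _ = ∫⁻ s in S, (c / 2) ^ B ∂m := by rw [setLIntegral_const]
      _ ≤ ∫⁻ s in S, m (Iic s) ^ B ∂m := by
          refine setLIntegral_mono' hSm fun s hs => ENNReal.rpow_le_rpow hs.2 hB
      _ ≤ _ := lintegral_mono_set inter_subset_left
  calc c ^ (B + 1) = 2 ^ (B + 1) * (c / 2) ^ (B + 1) := by
        rw [← ENNReal.mul_rpow_of_nonneg _ _ (by linarith), ENNReal.mul_div_cancel (by norm_num)
          (by norm_num)]
    _ ≤ _ := by gcongr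

/-- Reflection of the previous bound; the absence of atoms allows open and closed half-lines to be
exchanged. -/
theorem rpow_measure_Ioi_le (m : Measure ℝ) [NullSingletonClass m] {u : ℝ} (hu : m (Ioi u) ≠ ∞) {B : ℝ}
    (hB : 0 ≤ B) :
    m (Ioi u) ^ (B + 1) ≤ 2 ^ (B + 1) * ∫⁻ s in Ioi u, m (Ioi s) ^ B ∂m := by
  have h : ∀ s, (m.map Neg.neg) (Iic s) = m (Ioi (-s)) := fun s => by
    rw [Measure.map_apply measurable_neg measurableSet_Iic, neg_preimage, neg_Iic,
      measure_congr Ioi_ae_eq_Ici]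
  have key := rpow_measure_Iic_le (m.map Neg.neg) (u := -u) (by rwa [h, neg_neg]) hB
  simp only [h, neg_neg] at key
  have hm : Measurable fun s => m (Ioi (-s)) ^ B :=
    ((measurable_measure_Ioi m).comp measurable_neg).pow_const _
  rw [setLIntegral_map measurableSet_Iic hm measurable_neg, neg_preimage, neg_Iic, neg_neg,
    ← setLIntegral_congr Ioi_ae_eq_Ici] at key
  simpa only [neg_neg] using key

/-- The pointwise lower bound in u is integrated against ρ, and Tonelli moves the u-integral inside,
where the constraints s ≤ u and u ∈ S y leave a ρ-mass. It is used with S r = (-∞,r) and with the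
superlevel sets of T. -/
theorem measure_univ_le_of_kernel {Y : Type*} [MeasurableSpace Y] (ρ Λ : Measure ℝ) (η : Measure Y)
    [SFinite ρ] [SFinite Λ] [SFinite η] {S : Y → Set ℝ}
    (hS : MeasurableSet {z : ℝ × Y | z.1 ∈ S z.2}) {a : Y → ℝ≥0∞} (ha : Measurable a)
    {b : ℝ → ℝ≥0∞} (hb : Measurable b) (C : ℝ≥0∞)
    (h : ∀ᵐ u ∂ρ, 1 ≤ C * ((∫⁻ s in Iic u, b s ∂Λ) * ∫⁻ y in {y | u ∈ S y}, a y ∂η)) :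
    ρ univ ≤ C * ∫⁻ s, b s * ∫⁻ y, a y * ρ (Ici s ∩ S y) ∂η ∂Λ := by
  have hSy : ∀ y, MeasurableSet (S y) := fun y => measurable_prodMk_right (y := y) hS
  have hSu : ∀ u : ℝ, MeasurableSet {y | u ∈ S y} := fun u => measurable_prodMk_left (x := u) hS
  have hT : MeasurableSet {z : ℝ × ℝ | z.2 ≤ z.1} := measurableSet_le measurable_snd measurable_fst
  have hk : Measurable fun z : ℝ × Y => {z : ℝ × Y | z.1 ∈ S z.2}.indicator (fun z => a z.2) z :=
    (ha.comp measurable_snd).indicator hS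
  have hA : Measurable fun u : ℝ =>
      ∫⁻ y, {z : ℝ × Y | z.1 ∈ S z.2}.indicator (fun z => a z.2) (u, y) ∂η :=
    hk.lintegral_prod_right'
  have hb' : Measurable fun z : ℝ × ℝ => {z : ℝ × ℝ | z.2 ≤ z.1}.indicator (fun z => b z.2) z :=
    (hb.comp measurable_snd).indicator hT
  calc ρ univ = ∫⁻ _, 1 ∂ρ := by simp
    _ ≤ ∫⁻ u, C * ((∫⁻ s in Iic u, b s ∂Λ) * ∫⁻ y in {y | u ∈ S y}, a y ∂η) ∂ρ :=
        lintegral_mono_ae h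
    _ = ∫⁻ u, C * ∫⁻ s, {z : ℝ × ℝ | z.2 ≤ z.1}.indicator (fun z => b z.2) (u, s) *
          ∫⁻ y, {z : ℝ × Y | z.1 ∈ S z.2}.indicator (fun z => a z.2) (u, y) ∂η ∂Λ ∂ρ := by
        refine lintegral_congr fun u => ?_
        congr 1
        rw [← lintegral_indicator measurableSet_Iic, ← lintegral_indicator (hSu u)]
        exact (lintegral_mul_const _ (hb'.comp (measurable_prodMk_left (x := u)))).symm
    _ = C * ∫⁻ u, ∫⁻ s, {z : ℝ × ℝ | z.2 ≤ z.1}.indicator (fun z => b z.2) (u, s) *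
          ∫⁻ y, {z : ℝ × Y | z.1 ∈ S z.2}.indicator (fun z => a z.2) (u, y) ∂η ∂Λ ∂ρ := by
        refine lintegral_const_mul _ ?_
        exact (hb'.mul (hA.comp measurable_fst)).lintegral_prod_right'
    _ = C * ∫⁻ s, ∫⁻ u, {z : ℝ × ℝ | z.2 ≤ z.1}.indicator (fun z => b z.2) (u, s) *
          ∫⁻ y, {z : ℝ × Y | z.1 ∈ S z.2}.indicator (fun z => a z.2) (u, y) ∂η ∂ρ ∂Λ := by
        rw [lintegral_lintegral_swap (hb'.mul (hA.comp measurable_fst)).aemeasurable]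
    _ = C * ∫⁻ s, b s * ∫⁻ y, a y * ρ (Ici s ∩ S y) ∂η ∂Λ := by
        congr 1
        refine lintegral_congr fun s => ?_
        have h1 : ∀ u, {z : ℝ × ℝ | z.2 ≤ z.1}.indicator (fun z => b z.2) (u, s) *
            ∫⁻ y, {z : ℝ × Y | z.1 ∈ S z.2}.indicator (fun z => a z.2) (u, y) ∂η =
            (Ici s).indicator (fun u => b s *
              ∫⁻ y, {z : ℝ × Y | z.1 ∈ S z.2}.indicator (fun z => a z.2) (u, y) ∂η) u := fun u => by
          by_cases hu : s ≤ u <;> simp [indicator, hu]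
        simp_rw [h1]
        rw [lintegral_indicator measurableSet_Ici, lintegral_const_mul _ hA,
          lintegral_lintegral_swap hk.aemeasurable]
        congr 1
        refine lintegral_congr fun y => ?_
        have h2 : ∀ u, {z : ℝ × Y | z.1 ∈ S z.2}.indicator (fun z => a z.2) (u, y) =
            (S y).indicator (fun _ => a y) u := fun u => rfl
        simp_rw [h2]
        rw [lintegral_indicator (hSy y), lintegral_const, Measure.restrict_restrict (hSy y),
          Measure.restrict_apply_univ, inter_comm]

/-! ### Total mass from product bounds on intervals: 1 < θ < ∞, θ ≤ 1, θ = ∞ -/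

theorem ae_nonneg_of_measure_Iio_zero {Λ : Measure ℝ} (hΛ : Λ (Iio 0) = 0) : ∀ᵐ s ∂Λ, 0 ≤ s := by
  rw [ae_iff]; simpa [Iio] using hΛ

theorem ae_pos_of_measure_Iic_zero {η : Measure ℝ} (hη : η (Iic 0) = 0) : ∀ᵐ s ∂η, 0 < s := by
  rw [ae_iff]; simpa [Iic] using hη

theorem measurableSet_fst_lt_snd : MeasurableSet {z : ℝ × ℝ | z.1 ∈ Iio z.2} :=
  measurableSet_lt measurable_fst measurable_snd

theorem measure_univ_le_of_Ico_le {t q : ℝ} (htq : t.HolderConjugate q) {ρ Λ η : Measure ℝ}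
    [SFinite ρ] [SFinite Λ] [SFinite η] [NullSingletonClass η] (hΛ0 : Λ (Iio 0) = 0)
    (hΛ : ∀ s, 0 ≤ s → Λ (Iic s) = η (Ioi s) ^ (-(q / t))) (hη0 : η (Iic 0) = 0)
    (hη : ∀ u, 0 < u → η (Ioi u) ≠ 0 ∧ η (Ioi u) ≠ ∞) (hρ0 : ρ (Iic 0) = 0) {F G : ℝ → ℝ≥0∞}
    (hF : Antitone F) (hG : Monotone G) (hρ : ∀ s r, ρ (Ico s r) ≤ F s * G r) :
    ρ univ ≤ (2 : ℝ≥0∞) ^ (t / q ^ 2 + 1) * 2 ^ (q / t ^ 2 + 1) *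
      ((∫⁻ s, F s ^ q ∂Λ) ^ (1 / q) * (∫⁻ r, G r ^ t ∂η) ^ (1 / t)) := by
  have ht0 : 0 < t := htq.pos
  have hq0 : 0 < q := htq.symm.pos
  have hA : 0 ≤ q / t ^ 2 := by positivity
  have hB : 0 ≤ t / q ^ 2 := by positivity
  have hsum : t * q = t + q := htq.mul_eq_add
  have hm1 : Measurable fun s => Λ (Iic s) ^ (t / q ^ 2) := (measurable_measure_Iic Λ).pow_const _
  have hm2 : Measurable fun r => η (Ioi r) ^ (q / t ^ 2) := (measurable_measure_Ioi η).pow_const _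
  refine (measure_univ_le_of_kernel ρ Λ η measurableSet_fst_lt_snd hm2 hm1
    ((2 : ℝ≥0∞) ^ (t / q ^ 2 + 1) * 2 ^ (q / t ^ 2 + 1)) ?_).trans ?_
  · filter_upwards [ae_pos_of_measure_Iic_zero hρ0] with u hu
    obtain ⟨h0, h1⟩ := hη u hu
    have hΛu : Λ (Iic u) ≠ ∞ := by
      rw [hΛ u hu.le]; exact ENNReal.rpow_ne_top_of_ne_zero h0 h1
    have e1 := rpow_measure_Iic_le Λ hΛu hB
    have e2 := rpow_measure_Ioi_le η h1 hA
    -- The exponents are chosen for this cancellation: tq = t + q gives (t/q² + 1)(q/t) = q/t² + 1.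
    have e3 : Λ (Iic u) ^ (t / q ^ 2 + 1) * η (Ioi u) ^ (q / t ^ 2 + 1) = 1 := by
      rw [hΛ u hu.le, ← ENNReal.rpow_mul, ← ENNReal.rpow_add _ _ h0 h1]
      convert ENNReal.rpow_zero using 2
      field_simp
      linear_combination (t - q) * hsum
    calc (1 : ℝ≥0∞) = Λ (Iic u) ^ (t / q ^ 2 + 1) * η (Ioi u) ^ (q / t ^ 2 + 1) := e3.symm
      _ ≤ (2 ^ (t / q ^ 2 + 1) * ∫⁻ s in Iic u, Λ (Iic s) ^ (t / q ^ 2) ∂Λ) *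
          (2 ^ (q / t ^ 2 + 1) * ∫⁻ s in Ioi u, η (Ioi s) ^ (q / t ^ 2) ∂η) := by gcongr
      _ = _ := by
        rw [mul_mul_mul_comm]; rfl
  · gcongr
    set a : ℝ × ℝ → ℝ≥0∞ := {z : ℝ × ℝ | z.1 < z.2}.indicator
      fun z => F z.1 * Λ (Iic z.1) ^ (t / q ^ 2) with ha
    set b : ℝ × ℝ → ℝ≥0∞ := {z : ℝ × ℝ | z.1 < z.2}.indicator
      fun z => G z.2 * η (Ioi z.2) ^ (q / t ^ 2) with hb
    have hS : MeasurableSet {z : ℝ × ℝ | z.1 < z.2} := measurableSet_fst_lt_snd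
    have ham : Measurable a :=
      ((hF.measurable.mul hm1).comp measurable_fst).indicator hS
    have hbm : Measurable b :=
      ((hG.measurable.mul hm2).comp measurable_snd).indicator hS
    calc ∫⁻ s, Λ (Iic s) ^ (t / q ^ 2) * ∫⁻ r, η (Ioi r) ^ (q / t ^ 2) * ρ (Ici s ∩ Iio r) ∂η ∂Λ
        = ∫⁻ s, ∫⁻ r, Λ (Iic s) ^ (t / q ^ 2) * (η (Ioi r) ^ (q / t ^ 2) * ρ (Ici s ∩ Iio r)) ∂η ∂Λ := by
          refine lintegral_congr fun s => (lintegral_const_mul _ (hm2.mul ?_)).symm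
          exact Monotone.measurable fun _ _ h =>
            measure_mono (inter_subset_inter_right _ (Iio_subset_Iio h))
      _ ≤ ∫⁻ s, ∫⁻ r, (a * b) (s, r) ∂η ∂Λ := by
          refine lintegral_mono fun s => lintegral_mono fun r => ?_
          simp only [ha, hb, Pi.mul_apply, indicator, mem_ofPred_eq]
          split_ifs with h
          · calc _ ≤ Λ (Iic s) ^ (t / q ^ 2) * (η (Ioi r) ^ (q / t ^ 2) * (F s * G r)) := by
                  gcongr; exact hρ s r
              _ = _ := by ring
          · rw [Ici_inter_Iio, Ico_eq_empty h]; simp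
      _ = ∫⁻ z, (a * b) z ∂(Λ.prod η) := (lintegral_prod _ (ham.mul hbm).aemeasurable).symm
      _ ≤ (∫⁻ z, a z ^ q ∂(Λ.prod η)) ^ (1 / q) * (∫⁻ z, b z ^ t ∂(Λ.prod η)) ^ (1 / t) :=
          ENNReal.lintegral_mul_le_Lp_mul_Lq _ htq.symm ham.aemeasurable hbm.aemeasurable
      _ ≤ (∫⁻ s, F s ^ q ∂Λ) ^ (1 / q) * (∫⁻ r, G r ^ t ∂η) ^ (1 / t) := by
          gcongr
          · rw [lintegral_prod _ (ham.pow_const _).aemeasurable]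
            refine lintegral_mono_ae ?_
            filter_upwards [ae_nonneg_of_measure_Iio_zero hΛ0] with s hs
            -- The integral over r > s contributes η((s,∞)), which cancels against Λ(Iic s)^{t/q} =
            -- η((s,∞))⁻¹. The factor with b is treated symmetrically.
            have e : ∀ r, a (s, r) ^ q =
                (Ioi s).indicator (fun _ => (F s * Λ (Iic s) ^ (t / q ^ 2)) ^ q) r := fun r => by
              by_cases h : s < r <;> simp [ha, indicator, h, hq0]
            simp_rw [e]
            rw [lintegral_indicator_const measurableSet_Ioi, ENNReal.mul_rpow_of_nonneg _ _ hq0.le,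
              mul_assoc, hΛ s hs, ← ENNReal.rpow_mul, ← ENNReal.rpow_mul]
            have e' : -(q / t) * (t / q ^ 2 * q) = -1 := by field_simp
            rw [e', ENNReal.rpow_neg_one]
            exact (mul_le_mul_right (ENNReal.inv_mul_le_one _) _).trans (mul_one _).le
          · rw [lintegral_prod_symm _ (hbm.pow_const _).aemeasurable]
            refine lintegral_mono_ae ?_
            filter_upwards [ae_pos_of_measure_Iic_zero hη0] with r hr
            obtain ⟨h0, h1⟩ := hη r hr
            have e : ∀ s, b (s, r) ^ t =
                (Iio r).indicator (fun _ => (G r * η (Ioi r) ^ (q / t ^ 2)) ^ t) s := fun s => by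
              by_cases h : s < r <;> simp [hb, indicator, h, ht0]
            simp_rw [e]
            rw [lintegral_indicator_const measurableSet_Iio, ENNReal.mul_rpow_of_nonneg _ _ ht0.le,
              mul_assoc, ← ENNReal.rpow_mul]
            have e' : η (Ioi r) ^ (q / t ^ 2 * t) * Λ (Iio r) ≤ 1 := by
              calc _ ≤ η (Ioi r) ^ (q / t ^ 2 * t) * Λ (Iic r) := by
                    gcongr; exact Iio_subset_Iic_self
                _ = 1 := by
                    rw [hΛ r hr.le, ← ENNReal.rpow_add _ _ h0 h1]
                    convert ENNReal.rpow_zero using 2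
                    field_simp; ring
            exact (mul_le_mul_right e' _).trans (mul_one _).le

/-- The bound F(s) Λ(Iic s) ≤ D makes the s-integral trivial. What remains is G η^{1/t-1} = G^t (G^t
η)^{1/t-1}, with η taken on (r,∞), and the second factor is at most M^{1/t-1} because G is monotone.
-/
theorem measure_univ_le_of_Ico_le_of_le_one {t : ℝ} (ht : 0 < t) (ht1 : t ≤ 1) {ρ Λ η : Measure ℝ}
    [SFinite ρ] [SFinite Λ] [SFinite η] [NullSingletonClass η] (hΛ0 : Λ (Iio 0) = 0)
    (hΛ : ∀ s, 0 ≤ s → Λ (Iic s) = η (Ioi s) ^ (-t⁻¹)) (hη0 : η (Iic 0) = 0)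
    (hη : ∀ u, 0 < u → η (Ioi u) ≠ 0 ∧ η (Ioi u) ≠ ∞) (hρ0 : ρ (Iic 0) = 0) {F G : ℝ → ℝ≥0∞}
    (hG : Monotone G) (hρ : ∀ s r, ρ (Ico s r) ≤ F s * G r)
    {D : ℝ≥0∞} (hD : ∀ s, 0 ≤ s → F s * Λ (Iic s) ≤ D) :
    ρ univ ≤ (2 : ℝ≥0∞) ^ (2 : ℝ) * 2 ^ (2 / t) * (D * (∫⁻ r, G r ^ t ∂η) ^ t⁻¹) := by
  have hti : 1 ≤ t⁻¹ := (one_le_inv₀ ht).2 ht1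
  have hA : 0 ≤ 2 / t - 1 := by rw [div_eq_mul_inv]; linarith
  have hm1 : Measurable fun s => Λ (Iic s) := measurable_measure_Iic Λ
  have hm2 : Measurable fun r => η (Ioi r) ^ (2 / t - 1) := (measurable_measure_Ioi η).pow_const _
  set M := ∫⁻ r, G r ^ t ∂η with hM
  have hGM : ∀ r, G r ^ t * η (Ioi r) ≤ M := fun r => by
    calc G r ^ t * η (Ioi r) = ∫⁻ _ in Ioi r, G r ^ t ∂η := by rw [setLIntegral_const]
      _ ≤ ∫⁻ x in Ioi r, G x ^ t ∂η := by
          refine setLIntegral_mono' measurableSet_Ioi fun x hx => ?_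
          exact ENNReal.rpow_le_rpow (hG (le_of_lt hx)) ht.le
      _ ≤ M := setLIntegral_le_lintegral _ _
  refine (measure_univ_le_of_kernel ρ Λ η measurableSet_fst_lt_snd hm2 hm1
    ((2 : ℝ≥0∞) ^ (2 : ℝ) * 2 ^ (2 / t)) ?_).trans ?_
  · filter_upwards [ae_pos_of_measure_Iic_zero hρ0] with u hu
    obtain ⟨h0, h1⟩ := hη u hu
    have hΛu : Λ (Iic u) ≠ ∞ := by
      rw [hΛ u hu.le]; exact ENNReal.rpow_ne_top_of_ne_zero h0 h1
    have e1 := rpow_measure_Iic_le Λ hΛu zero_le_one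
    have e2 := rpow_measure_Ioi_le η h1 hA
    rw [sub_add_cancel] at e2
    simp only [ENNReal.rpow_one, one_add_one_eq_two] at e1
    have e3 : Λ (Iic u) ^ (2 : ℝ) * η (Ioi u) ^ (2 / t) = 1 := by
      rw [hΛ u hu.le, ← ENNReal.rpow_mul, ← ENNReal.rpow_add _ _ h0 h1]
      convert ENNReal.rpow_zero using 2
      field_simp; ring
    calc (1 : ℝ≥0∞) = Λ (Iic u) ^ (2 : ℝ) * η (Ioi u) ^ (2 / t) := e3.symm
      _ ≤ (2 ^ (2 : ℝ) * ∫⁻ s in Iic u, Λ (Iic s) ∂Λ) *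
          (2 ^ (2 / t) * ∫⁻ s in Ioi u, η (Ioi s) ^ (2 / t - 1) ∂η) := by gcongr
      _ = _ := by
        rw [mul_mul_mul_comm]; rfl
  · gcongr
    have hS : MeasurableSet {z : ℝ × ℝ | z.1 < z.2} := measurableSet_fst_lt_snd
    set c : ℝ × ℝ → ℝ≥0∞ := {z : ℝ × ℝ | z.1 < z.2}.indicator
      fun z => D * (η (Ioi z.2) ^ (2 / t - 1) * G z.2) with hc
    have hcm : Measurable c :=
      (((hm2.mul hG.measurable).const_mul D).comp measurable_snd).indicator hS
    calc ∫⁻ s, Λ (Iic s) * ∫⁻ r, η (Ioi r) ^ (2 / t - 1) * ρ (Ici s ∩ Iio r) ∂η ∂Λ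
        = ∫⁻ s, ∫⁻ r, Λ (Iic s) * (η (Ioi r) ^ (2 / t - 1) * ρ (Ici s ∩ Iio r)) ∂η ∂Λ := by
          refine lintegral_congr fun s => (lintegral_const_mul _ (hm2.mul ?_)).symm
          exact Monotone.measurable fun _ _ h =>
            measure_mono (inter_subset_inter_right _ (Iio_subset_Iio h))
      _ ≤ ∫⁻ s, ∫⁻ r, c (s, r) ∂η ∂Λ := by
          refine lintegral_mono_ae ?_
          filter_upwards [ae_nonneg_of_measure_Iio_zero hΛ0] with s hs
          refine lintegral_mono fun r => ?_
          simp only [hc, indicator, mem_ofPred_eq]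
          split_ifs with h
          · calc _ ≤ Λ (Iic s) * (η (Ioi r) ^ (2 / t - 1) * (F s * G r)) := by
                  gcongr; exact hρ s r
              _ = (F s * Λ (Iic s)) * (η (Ioi r) ^ (2 / t - 1) * G r) := by ring
              _ ≤ _ := by gcongr; exact hD s hs
          · rw [Ici_inter_Iio, Ico_eq_empty h]; simp
      _ = ∫⁻ r, ∫⁻ s, c (s, r) ∂Λ ∂η := lintegral_lintegral_swap hcm.aemeasurable
      _ ≤ ∫⁻ r, D * M ^ (t⁻¹ - 1) * G r ^ t ∂η := by
          refine lintegral_mono_ae ?_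
          filter_upwards [ae_pos_of_measure_Iic_zero hη0] with r hr
          obtain ⟨h0, h1⟩ := hη r hr
          have e : ∀ s, c (s, r) =
              (Iio r).indicator (fun _ => D * (η (Ioi r) ^ (2 / t - 1) * G r)) s := fun s => rfl
          simp_rw [e]
          rw [lintegral_indicator_const measurableSet_Iio]
          have e1 : η (Ioi r) ^ (2 / t - 1) * Λ (Iio r) ≤ η (Ioi r) ^ (t⁻¹ - 1) := by
            calc _ ≤ η (Ioi r) ^ (2 / t - 1) * Λ (Iic r) := by
                  gcongr; exact Iio_subset_Iic_self
              _ = _ := by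
                  rw [hΛ r hr.le, ← ENNReal.rpow_add _ _ h0 h1]
                  congr 1; ring
          have e2 : G r = G r ^ t * (G r ^ t) ^ (t⁻¹ - 1) := by
            rw [← ENNReal.rpow_mul, ← ENNReal.rpow_add_of_nonneg _ _ ht.le
              (mul_nonneg ht.le (by linarith)), mul_sub, mul_inv_cancel₀ ht.ne', mul_one,
              add_sub_cancel, ENNReal.rpow_one]
          calc D * (η (Ioi r) ^ (2 / t - 1) * G r) * Λ (Iio r)
              = D * ((η (Ioi r) ^ (2 / t - 1) * Λ (Iio r)) * G r) := by ring
            _ ≤ D * (η (Ioi r) ^ (t⁻¹ - 1) * G r) := by gcongr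
            _ = D * (G r ^ t * η (Ioi r)) ^ (t⁻¹ - 1) * G r ^ t := by
                rw [ENNReal.mul_rpow_of_nonneg _ _ (by linarith)]
                nth_rewrite 1 [e2]
                ring
            _ ≤ D * M ^ (t⁻¹ - 1) * G r ^ t := by
                gcongr
                exact hGM r
      _ = D * M ^ t⁻¹ := by
          rw [lintegral_const_mul _ (hG.measurable.pow_const _), ← hM, mul_assoc]
          congr 1
          nth_rewrite 2 [← ENNReal.rpow_one M]
          rw [← ENNReal.rpow_add_of_nonneg _ _ (by linarith) zero_le_one, sub_add_cancel]

/-- For θ = ∞ there is no density whose tail mass is T, so T(u)² is recovered by integrating τ over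
0 < τ < T(u). On {T > τ} the hypothesis G T ≤ N gives G ≤ N/τ, and the factor τ cancels. -/
theorem measure_univ_le_of_Ico_le_of_mul_le {ρ Λ : Measure ℝ} [SFinite ρ] [SFinite Λ]
    {T : ℝ → ℝ≥0∞} (hT : Antitone T) (hT0 : ∀ u, 0 < u → T u ≠ 0 ∧ T u ≠ ∞)
    (hTr : ∀ u τ, τ < T u → ∃ r, u < r ∧ τ < T r)
    (hΛ0 : Λ (Iio 0) = 0) (hΛ : ∀ s, 0 ≤ s → Λ (Iic s) = (T s)⁻¹)
    (hρ0 : ρ (Iic 0) = 0) {F G : ℝ → ℝ≥0∞}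
    (hF : Antitone F) (hρ : ∀ s r, ρ (Ico s r) ≤ F s * G r)
    {N : ℝ≥0∞} (hN : ∀ r, G r * T r ≤ N) :
    ρ univ ≤ (2 : ℝ≥0∞) ^ (2 : ℝ) * 2 ^ (2 : ℝ) * (N * ∫⁻ s, F s ∂Λ) := by
  have hm1 : Measurable fun s => Λ (Iic s) := measurable_measure_Iic Λ
  have hS : MeasurableSet {z : ℝ × ℝ | z.1 ∈ {u | ENNReal.ofReal z.2 < T u}} :=
    measurableSet_lt (ENNReal.measurable_ofReal.comp measurable_snd)
      (hT.measurable.comp measurable_fst)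
  have hSρ : ∀ s τ, 0 < τ → ρ (Ici s ∩ {u | ENNReal.ofReal τ < T u}) ≤
      F s * (N / ENNReal.ofReal τ) := fun s τ hτ => by
    -- Half-open intervals omit their right endpoint, so right continuity (`hTr`) supplies a larger
    -- point where T still exceeds τ.
    have hsub : Ici s ∩ {u | ENNReal.ofReal τ < T u} ⊆
        ⋃ q ∈ {q : ℚ | ENNReal.ofReal τ < T q}, Ico s (q : ℝ) := by
      rintro u ⟨hsu, hu⟩
      obtain ⟨r, hur, hr⟩ := hTr u _ hu
      obtain ⟨q, hq1, hq2⟩ := exists_rat_btwn hur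
      exact mem_biUnion (show ENNReal.ofReal τ < T q from hr.trans_le (hT hq2.le)) ⟨hsu, hq1⟩
    refine (measure_mono hsub).trans ?_
    rw [measure_biUnion_eq_iSup (to_countable _)]
    · refine iSup₂_le fun q hq => (hρ s q).trans ?_
      gcongr
      rw [ENNReal.le_div_iff_mul_le (Or.inl (by simpa using hτ)) (Or.inl ENNReal.ofReal_ne_top)]
      refine le_trans ?_ (hN q)
      gcongr
      exact le_of_lt hq
    · intro a ha b hb
      rcases le_total a b with hab | hab
      · exact ⟨b, hb, Ico_subset_Ico_right (Rat.cast_le.2 hab), subset_rfl⟩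
      · exact ⟨a, ha, subset_rfl, Ico_subset_Ico_right (Rat.cast_le.2 hab)⟩
  refine (measure_univ_le_of_kernel ρ Λ (volume.restrict (Ioi (0 : ℝ)))
    (S := fun τ => {u | ENNReal.ofReal τ < T u}) hS
    ENNReal.measurable_ofReal hm1 ((2 : ℝ≥0∞) ^ (2 : ℝ) * 2 ^ (2 : ℝ)) ?_).trans ?_
  · filter_upwards [ae_pos_of_measure_Iic_zero hρ0] with u hu
    obtain ⟨h0, h1⟩ := hT0 u hu
    have hΛu : Λ (Iic u) ≠ ∞ := by
      rw [hΛ u hu.le]; exact ENNReal.inv_ne_top.2 h0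
    have e1 := rpow_measure_Iic_le Λ hΛu zero_le_one
    simp only [ENNReal.rpow_one, one_add_one_eq_two] at e1
    set c := (T u).toReal with hc
    have hcT : ENNReal.ofReal c = T u := ENNReal.ofReal_toReal h1
    have hc0 : 0 < c := ENNReal.toReal_pos h0 h1
    have e2 : T u ^ (2 : ℝ) ≤ 2 ^ (2 : ℝ) *
        ∫⁻ τ in {τ | u ∈ {u | ENNReal.ofReal τ < T u}}, ENNReal.ofReal τ
          ∂(volume.restrict (Ioi (0 : ℝ))) := by
      have hms : MeasurableSet {τ : ℝ | u ∈ {u | ENNReal.ofReal τ < T u}} :=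
        measurable_prodMk_left (x := u) hS
      -- Only τ between T(u)/2 and T(u) is kept.
      have : T u / 2 * (T u / 2) ≤ ∫⁻ τ in {τ | u ∈ {u | ENNReal.ofReal τ < T u}},
          ENNReal.ofReal τ ∂(volume.restrict (Ioi (0 : ℝ))) := by
        rw [Measure.restrict_restrict hms]
        have h2 : T u / 2 = ENNReal.ofReal (c / 2) := by
          rw [ENNReal.ofReal_div_of_pos two_pos, hcT, ENNReal.ofReal_ofNat]
        calc T u / 2 * (T u / 2) = ∫⁻ _ in Ioo (c / 2) c, ENNReal.ofReal (c / 2) := by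
              rw [setLIntegral_const, Real.volume_Ioo, h2]; congr 2; ring
          _ ≤ ∫⁻ τ in Ioo (c / 2) c, ENNReal.ofReal τ :=
              setLIntegral_mono' measurableSet_Ioo fun τ hτ => ENNReal.ofReal_le_ofReal hτ.1.le
          _ ≤ _ := by
              refine lintegral_mono_set fun τ hτ => ⟨?_, ?_⟩
              · change ENNReal.ofReal τ < T u
                rw [← hcT]; exact (ENNReal.ofReal_lt_ofReal_iff hc0).2 hτ.2
              · exact lt_trans (half_pos hc0) hτ.1
      calc T u ^ (2 : ℝ) = 2 ^ (2 : ℝ) * (T u / 2) ^ (2 : ℝ) := by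
            rw [← ENNReal.mul_rpow_of_nonneg _ _ (by norm_num), ENNReal.mul_div_cancel
              (by norm_num) (by norm_num)]
        _ ≤ _ := by
            gcongr
            rwa [ENNReal.rpow_two, sq]
    have e3 : Λ (Iic u) ^ (2 : ℝ) * T u ^ (2 : ℝ) = 1 := by
      rw [hΛ u hu.le, ← ENNReal.mul_rpow_of_nonneg _ _ (by norm_num), ENNReal.inv_mul_cancel h0 h1,
        ENNReal.one_rpow]
    calc (1 : ℝ≥0∞) = Λ (Iic u) ^ (2 : ℝ) * T u ^ (2 : ℝ) := e3.symm
      _ ≤ _ * _ := mul_le_mul' e1 e2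
      _ = _ := by rw [mul_mul_mul_comm]; rfl
  · gcongr
    calc ∫⁻ s, Λ (Iic s) * (∫⁻ τ in Ioi (0 : ℝ), ENNReal.ofReal τ *
          ρ (Ici s ∩ {u | ENNReal.ofReal τ < T u})) ∂Λ
        ≤ ∫⁻ s, N * F s ∂Λ := by
          refine lintegral_mono_ae ?_
          filter_upwards [ae_nonneg_of_measure_Iio_zero hΛ0] with s hs
          have e1 : ∫⁻ τ in Ioi (0 : ℝ), ENNReal.ofReal τ *
              ρ (Ici s ∩ {u | ENNReal.ofReal τ < T u}) ≤ N * F s * T s := by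
            have hms : MeasurableSet {τ : ℝ | ENNReal.ofReal τ < T s} :=
              measurableSet_lt ENNReal.measurable_ofReal measurable_const
            calc _ ≤ ∫⁻ τ in Ioi (0 : ℝ), {τ : ℝ | ENNReal.ofReal τ < T s}.indicator
                    (fun _ => N * F s) τ := by
                  refine setLIntegral_mono' measurableSet_Ioi fun τ hτ => ?_
                  have hτ0 : ENNReal.ofReal τ ≠ 0 := by simpa using hτ
                  by_cases h : ENNReal.ofReal τ < T s
                  · rw [indicator_of_mem (by exact h)]
                    calc _ ≤ ENNReal.ofReal τ * (F s * (N / ENNReal.ofReal τ)) := by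
                          gcongr; exact hSρ s τ hτ
                      _ = F s * (ENNReal.ofReal τ * (N / ENNReal.ofReal τ)) := by ring
                      _ = N * F s := by
                          rw [ENNReal.mul_div_cancel hτ0 ENNReal.ofReal_ne_top, mul_comm]
                  · have : Ici s ∩ {u | ENNReal.ofReal τ < T u} = ∅ := by
                      ext u
                      simp only [mem_inter_iff, mem_Ici, mem_ofPred_eq, mem_empty_iff_false,
                        iff_false, not_and]
                      exact fun hsu hu => h (hu.trans_le (hT hsu))
                    simp [this]
              _ = N * F s * volume ({τ : ℝ | ENNReal.ofReal τ < T s} ∩ Ioi 0) := by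
                  rw [lintegral_indicator_const hms, Measure.restrict_apply hms]
              _ ≤ N * F s * T s := by
                  gcongr
                  by_cases h : T s = ∞
                  · simp [h]
                  · calc _ ≤ volume (Ioo 0 (T s).toReal) := by
                          refine measure_mono fun τ hτ => ⟨hτ.2, ?_⟩
                          exact (ENNReal.ofReal_lt_iff_lt_toReal (le_of_lt hτ.2) h).1 hτ.1
                      _ = T s := by rw [Real.volume_Ioo, sub_zero, ENNReal.ofReal_toReal h]
          calc _ ≤ (T s)⁻¹ * (N * F s * T s) := by rw [hΛ s hs]; gcongr
            _ = N * F s * ((T s)⁻¹ * T s) := by ring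
            _ ≤ N * F s * 1 := by gcongr; exact ENNReal.inv_mul_le_one _
            _ = N * F s := mul_one _
      _ = N * ∫⁻ s, F s ∂Λ := lintegral_const_mul _ hF.measurable

/-! ### Weighted Hölder inequality and its near-extremal functions -/

theorem conjExponent_one : (1 : ℝ≥0∞).conjExponent = ∞ := by simp [ENNReal.conjExponent]

theorem conjExponent_top : (∞ : ℝ≥0∞).conjExponent = 1 := by simp [ENNReal.conjExponent]

theorem conjExponent_ne_top {p : ℝ≥0∞} (hp : 1 < p) : p.conjExponent ≠ ∞ := by
  simp [ENNReal.conjExponent, ENNReal.add_eq_top, tsub_eq_zero_iff_le, hp]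

theorem holderConjugate_toReal {p : ℝ≥0∞} (hp : 1 < p) (hp' : p ≠ ∞) :
    p.toReal.HolderConjugate p.conjExponent.toReal := by
  have h1 : 1 < p.toReal := by
    rwa [← ENNReal.toReal_one, ENNReal.toReal_lt_toReal ENNReal.one_ne_top hp']
  rw [Real.holderConjugate_iff_eq_conjExponent h1, ENNReal.conjExponent, ENNReal.toReal_add
    ENNReal.one_ne_top (by simp [tsub_eq_zero_iff_le, hp]), ENNReal.toReal_inv,
    ENNReal.toReal_sub_of_le hp.le hp', ENNReal.toReal_one]
  have : p.toReal - 1 ≠ 0 := by linarith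
  field_simp
  ring

/-- Hölder after inserting v^{-1/p} v^{1/p} = 1; the two sets are kept apart so that A ∩ B can be an
annulus. -/
theorem lintegral_mul_le_wNorm {n : ℕ} {p : ℝ≥0∞} (hp : 1 ≤ p) (hp' : p ≠ ∞)
    {v : RSpace n → ℝ≥0∞} (hv : IsWeight v) {h g : RSpace n → ℝ≥0∞} (hh : AEMeasurable h)
    (hg : AEMeasurable g) (A B : Set (RSpace n)) :
    ∫⁻ x in A ∩ B, h x * g x ≤ wNorm p.conjExponent (dualWeight p v) A h * wNorm p v B g := by
  have hv' : ∀ᵐ x ∂(volume.restrict (A ∩ B)), 0 < v x ∧ v x < ∞ := ae_restrict_of_ae hv.2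
  rcases hp.eq_or_lt with rfl | hp1
  · rw [conjExponent_one, wNorm_top, wNorm_of_ne_top hp']
    set S := essSup (fun x => h x * dualWeight 1 v x) (volume.restrict A) with hS
    have hle : ∀ᵐ x ∂(volume.restrict (A ∩ B)), h x * (v x)⁻¹ ≤ S := by
      refine ae_mono (Measure.restrict_mono_set _ inter_subset_left) ?_
      filter_upwards [ENNReal.ae_le_essSup (μ := volume.restrict A)
        (fun x => h x * dualWeight 1 v x)] with x hx
      simpa [hS, dualWeight] using hx
    simp only [ENNReal.toReal_one, ENNReal.rpow_one, inv_one]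
    calc ∫⁻ x in A ∩ B, h x * g x ≤ ∫⁻ x in A ∩ B, S * (g x * v x) := by
          refine lintegral_mono_ae ?_
          filter_upwards [hle, hv'] with x hx hvx
          calc h x * g x = h x * ((v x)⁻¹ * v x) * g x := by
                rw [ENNReal.inv_mul_cancel hvx.1.ne' hvx.2.ne, mul_one]
            _ = h x * (v x)⁻¹ * (g x * v x) := by ring
            _ ≤ _ := by gcongr
      _ = S * ∫⁻ x in A ∩ B, g x * v x := lintegral_const_mul'' _ (hg.mul hv.1).restrict
      _ ≤ _ := by gcongr; exact inter_subset_right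
  · have hc := holderConjugate_toReal hp1 hp'
    rw [wNorm_of_ne_top hp', wNorm_of_ne_top (conjExponent_ne_top hp1)]
    set P := p.toReal
    set Q := p.conjExponent.toReal
    have hP : 0 < P := hc.pos
    have hQ : 0 < Q := hc.symm.pos
    have hPQ : -P⁻¹ * Q = 1 - Q := by
      have := hc.mul_eq_add
      field_simp; linarith
    calc ∫⁻ x in A ∩ B, h x * g x
        = ∫⁻ x in A ∩ B, ((fun x => h x * v x ^ (-P⁻¹)) * fun x => g x * v x ^ P⁻¹) x := by
          refine lintegral_congr_ae ?_
          filter_upwards [hv'] with x hvx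
          have : v x ^ (-P⁻¹) * v x ^ P⁻¹ = 1 := by
            rw [← ENNReal.rpow_add _ _ hvx.1.ne' hvx.2.ne, neg_add_cancel, ENNReal.rpow_zero]
          rw [Pi.mul_apply, mul_mul_mul_comm, this, mul_one]
      _ ≤ (∫⁻ x in A ∩ B, (h x * v x ^ (-P⁻¹)) ^ Q) ^ (1 / Q) *
          (∫⁻ x in A ∩ B, (g x * v x ^ P⁻¹) ^ P) ^ (1 / P) :=
          ENNReal.lintegral_mul_le_Lp_mul_Lq _ hc.symm
            (hh.mul (hv.1.pow_const _)).restrict (hg.mul (hv.1.pow_const _)).restrict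
      _ ≤ _ := by
          rw [one_div, one_div]
          gcongr ?_ ^ _ * ?_ ^ _
          · refine (lintegral_mono_set inter_subset_left).trans_eq (lintegral_congr fun x => ?_)
            rw [ENNReal.mul_rpow_of_nonneg _ _ hQ.le, ← ENNReal.rpow_mul, hPQ, dualWeight,
              if_neg hp1.ne']
          · refine (lintegral_mono_set inter_subset_right).trans_eq (lintegral_congr fun x => ?_)
            rw [ENNReal.mul_rpow_of_nonneg _ _ hP.le, ← ENNReal.rpow_mul,
              inv_mul_cancel₀ hP.ne', ENNReal.rpow_one]

theorem exists_measurable_nnreal_le_of_lt_lintegral {α : Type*} [MeasurableSpace α] {μ : Measure α}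
    [SigmaFinite μ] {f : α → ℝ≥0∞} {L : ℝ≥0∞} (hL : L < ∫⁻ x, f x ∂μ) :
    ∃ ψ : α → ℝ≥0, Measurable ψ ∧ (∀ x, (ψ x : ℝ≥0∞) ≤ f x) ∧ ∫⁻ x, ψ x ∂μ ≠ ∞ ∧
      L < ∫⁻ x, ψ x ∂μ := by
  rw [lintegral_eq_nnreal] at hL
  simp only [lt_iSup_iff] at hL
  obtain ⟨φ, hφ, hL⟩ := hL
  rw [← SimpleFunc.lintegral_eq_lintegral] at hL
  obtain ⟨ψ, hψ, hfin, hlt⟩ := SimpleFunc.exists_lt_lintegral_simpleFunc_of_lt_lintegral hL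
  exact ⟨ψ, ψ.measurable, fun x => (ENNReal.coe_le_coe.2 (hψ x)).trans (hφ x), hfin.ne, hlt⟩

/-- The dual norm may be infinite or unattained, hence the strict bound K. The function is (ψ/(v
I))^{1/p} with I = ∫ ψ finite and positive, where ψ minorizes h^{p'} v^{1-p'} on A if p > 1, and
minorizes v on the set where h/v exceeds K if p = 1. -/
theorem exists_testFunction {n : ℕ} {p : ℝ≥0∞} (hp : 1 ≤ p) (hp' : p ≠ ∞)
    {v : RSpace n → ℝ≥0∞} (hv : IsWeight v) {h : RSpace n → ℝ≥0∞} (hh : AEMeasurable h)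
    {A : Set (RSpace n)} (hA : MeasurableSet A) {K : ℝ≥0∞}
    (hK : K < wNorm p.conjExponent (dualWeight p v) A h) :
    ∃ g : RSpace n → ℝ≥0∞, AEMeasurable g ∧ (∀ x ∉ A, g x = 0) ∧
      ∫⁻ x, g x ^ p.toReal * v x ≤ 1 ∧ K ≤ ∫⁻ x, h x * g x := by
  have hP : 0 < p.toReal := ENNReal.toReal_pos (zero_lt_one.trans_le hp).ne' hp'
  have hnorm : ∀ (ψ : RSpace n → ℝ≥0) (I : ℝ≥0∞), Measurable ψ → ∫⁻ x, ψ x = I → I ≠ ∞ →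
      I ≠ 0 → ∫⁻ x, ((ψ x / (v x * I) : ℝ≥0∞) ^ (p.toReal)⁻¹) ^ p.toReal * v x ≤ 1 := by
    intro ψ I hψ hI hI1 hI0
    calc _ = ∫⁻ x, ψ x * I⁻¹ := by
          refine lintegral_congr_ae ?_
          filter_upwards [hv.2] with x hvx
          rw [← ENNReal.rpow_mul, inv_mul_cancel₀ hP.ne', ENNReal.rpow_one, div_eq_mul_inv,
            ENNReal.mul_inv (Or.inl hvx.1.ne') (Or.inl hvx.2.ne), mul_assoc, mul_right_comm,
            ENNReal.inv_mul_cancel hvx.1.ne' hvx.2.ne, one_mul]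
      _ = I * I⁻¹ := by rw [lintegral_mul_const _ hψ.coe_nnreal_ennreal, hI]
      _ ≤ 1 := ENNReal.mul_inv_le_one _
  rcases hp.eq_or_lt with rfl | hp1
  · rw [conjExponent_one, wNorm_top] at hK
    set S := {x | x ∈ A ∧ K < h x * (v x)⁻¹} with hS
    have hSm : NullMeasurableSet S :=
      hA.nullMeasurableSet.inter (nullMeasurableSet_lt aemeasurable_const (hh.mul hv.1.inv))
    have hpos : 0 < ∫⁻ x, S.indicator v x := by
      rw [pos_iff_ne_zero]
      intro h0
      rw [lintegral_eq_zero_iff' (hv.1.indicator₀ hSm)] at h0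
      refine hK.not_ge (essSup_le_of_ae_le _ ?_)
      rw [Filter.EventuallyLE, ae_restrict_iff' hA]
      filter_upwards [h0, hv.2] with x hx hvx hxA
      by_contra hlt
      have hxS : x ∈ S := ⟨hxA, by simpa [dualWeight] using hlt⟩
      rw [indicator_of_mem hxS] at hx
      exact hvx.1.ne' hx
    obtain ⟨ψ, hψm, hψ, hfin, hlt⟩ := exists_measurable_nnreal_le_of_lt_lintegral hpos
    set I := ∫⁻ x, (ψ x : ℝ≥0∞) with hI
    refine ⟨fun x => (ψ x / (v x * I) : ℝ≥0∞) ^ (ENNReal.toReal 1)⁻¹, ?_, ?_,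
      hnorm ψ I hψm rfl hfin hlt.ne', ?_⟩
    · exact (hψm.coe_nnreal_ennreal.aemeasurable.div (hv.1.mul_const _)).pow_const _
    · intro x hx
      have : (ψ x : ℝ≥0∞) = 0 := by
        have h1 := hψ x
        rw [indicator_of_notMem (fun h => hx h.1)] at h1
        exact le_antisymm h1 zero_le
      simp [this]
    · calc K = K * (I * I⁻¹) := by rw [ENNReal.mul_inv_cancel hlt.ne' hfin, mul_one]
        _ = ∫⁻ x, K * (ψ x * I⁻¹) := by
            rw [lintegral_const_mul _ (hψm.coe_nnreal_ennreal.mul_const _),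
              lintegral_mul_const _ hψm.coe_nnreal_ennreal]
        _ ≤ _ := by
            refine lintegral_mono_ae ?_
            filter_upwards [hv.2] with x hvx
            rw [ENNReal.toReal_one, inv_one, ENNReal.rpow_one, div_eq_mul_inv,
              ENNReal.mul_inv (Or.inl hvx.1.ne') (Or.inl hvx.2.ne)]
            by_cases hx : x ∈ S
            · calc K * (ψ x * I⁻¹) ≤ h x * (v x)⁻¹ * (ψ x * I⁻¹) := by
                    gcongr; exact hx.2.le
                _ = _ := by ring
            · have : (ψ x : ℝ≥0∞) = 0 := by
                have h1 := hψ x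
                rw [indicator_of_notMem hx] at h1
                exact le_antisymm h1 zero_le
              simp [this]
  · have hc := holderConjugate_toReal hp1 hp'
    rw [wNorm_of_ne_top (conjExponent_ne_top hp1)] at hK
    set P := p.toReal with hPdef
    set Q := p.conjExponent.toReal
    have hQ : 0 < Q := hc.symm.pos
    have hPQ : P⁻¹ * Q = Q - 1 := by
      have := hc.mul_eq_add
      field_simp; linarith
    rw [ENNReal.lt_rpow_inv_iff hQ, ← lintegral_indicator hA] at hK
    obtain ⟨ψ, hψm, hψ, hfin, hlt⟩ := exists_measurable_nnreal_le_of_lt_lintegral hK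
    set I := ∫⁻ x, (ψ x : ℝ≥0∞) with hI
    have hI0 : I ≠ 0 := (zero_le.trans_lt hlt).ne'
    have hψA : ∀ x ∉ A, (ψ x : ℝ≥0∞) = 0 := fun x hx => by
      have h1 := hψ x
      rw [indicator_of_notMem hx] at h1
      exact le_antisymm h1 zero_le
    refine ⟨fun x => (ψ x / (v x * I) : ℝ≥0∞) ^ P⁻¹, ?_, ?_, hnorm ψ I hψm rfl hfin hI0, ?_⟩
    · exact (hψm.coe_nnreal_ennreal.aemeasurable.div (hv.1.mul_const _)).pow_const _
    · intro x hx
      simp [hψA x hx, hP]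
    · have hsum : Q⁻¹ + P⁻¹ = 1 := hc.symm.inv_add_inv_eq_one
      calc K ≤ I ^ Q⁻¹ := ((ENNReal.lt_rpow_inv_iff hQ).2 hlt).le
        _ = I * (I⁻¹) ^ P⁻¹ := by
            rw [ENNReal.inv_rpow, ← ENNReal.rpow_neg]
            nth_rewrite 2 [← ENNReal.rpow_one I]
            rw [← ENNReal.rpow_add _ _ hI0 hfin]
            congr 1; linarith
        _ = ∫⁻ x, ψ x * (I⁻¹) ^ P⁻¹ := by rw [lintegral_mul_const _ hψm.coe_nnreal_ennreal]
        _ ≤ _ := by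
            refine lintegral_mono_ae ?_
            filter_upwards [hv.2] with x hvx
            by_cases hx : x ∈ A
            · have h1 := hψ x
              rw [indicator_of_mem hx, dualWeight, if_neg hp1.ne'] at h1
              -- The p'-th root of ψ ≤ h^{p'} v^{1-p'}; it makes ∫ h g at least I^{1/p'}.
              have h2 : (ψ x : ℝ≥0∞) ^ Q⁻¹ * v x ^ P⁻¹ ≤ h x := by
                rw [← ENNReal.rpow_le_rpow_iff hQ, ENNReal.mul_rpow_of_nonneg _ _ hQ.le,
                  ← ENNReal.rpow_mul, ← ENNReal.rpow_mul, inv_mul_cancel₀ hQ.ne',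
                  ENNReal.rpow_one, hPQ]
                calc (ψ x : ℝ≥0∞) * v x ^ (Q - 1) ≤ h x ^ Q * v x ^ (1 - Q) * v x ^ (Q - 1) := by
                      gcongr
                  _ = h x ^ Q := by
                      rw [mul_assoc, ← ENNReal.rpow_add _ _ hvx.1.ne' hvx.2.ne]
                      simp
              calc (ψ x : ℝ≥0∞) * I⁻¹ ^ P⁻¹
                  = (ψ x : ℝ≥0∞) ^ Q⁻¹ * v x ^ P⁻¹ * (ψ x / (v x * I) : ℝ≥0∞) ^ P⁻¹ := by
                    rw [div_eq_mul_inv, ENNReal.mul_inv (Or.inl hvx.1.ne') (Or.inl hvx.2.ne),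
                      ENNReal.mul_rpow_of_nonneg _ _ (inv_nonneg.2 hP.le),
                      ENNReal.mul_rpow_of_nonneg _ _ (inv_nonneg.2 hP.le)]
                    have e1 : (ψ x : ℝ≥0∞) ^ Q⁻¹ * (ψ x : ℝ≥0∞) ^ P⁻¹ = ψ x := by
                      rw [← ENNReal.rpow_add_of_nonneg _ _ (inv_nonneg.2 hQ.le)
                        (inv_nonneg.2 hP.le), hsum, ENNReal.rpow_one]
                    have e2 : v x ^ P⁻¹ * (v x)⁻¹ ^ P⁻¹ = 1 := by
                      rw [← ENNReal.mul_rpow_of_nonneg _ _ (inv_nonneg.2 hP.le),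
                        ENNReal.mul_inv_cancel hvx.1.ne' hvx.2.ne, ENNReal.one_rpow]
                    calc _ = ((ψ x : ℝ≥0∞) ^ Q⁻¹ * (ψ x : ℝ≥0∞) ^ P⁻¹) *
                          (v x ^ P⁻¹ * (v x)⁻¹ ^ P⁻¹) * I⁻¹ ^ P⁻¹ := by rw [e1, e2, mul_one]
                      _ = _ := by ring
                _ ≤ _ := by gcongr
            · simp [hψA x hx]

/-! ### Superpositions of test functions and the basic lower bound -/

theorem ereal_abs_coe_ennreal (x : ℝ≥0∞) : ((x : EReal)).abs = x := by
  induction x with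
  | top => simp
  | coe x =>
    rw [show (((x : ℝ≥0∞)) : EReal) = ((x : ℝ) : EReal) from rfl, EReal.abs_def,
      NNReal.abs_eq, ENNReal.ofReal_coe_nnreal]

theorem measurable_ereal_abs : Measurable EReal.abs := by
  have h : EReal.abs = fun x : EReal => max x.toENNReal (-x).toENNReal := by
    funext x
    induction x with
    | bot => simp
    | top => simp
    | coe x =>
      rw [EReal.abs_def, ← EReal.coe_neg, EReal.toENNReal_of_ne_top (EReal.coe_ne_top _),
        EReal.toENNReal_of_ne_top (EReal.coe_ne_top _), EReal.toReal_coe, EReal.toReal_coe,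
        abs_eq_max_neg, ENNReal.ofReal_max]
  rw [h]
  exact measurable_ereal_toENNReal.max (measurable_ereal_toENNReal.comp measurable_neg)

theorem wNorm_mono {α : Type*} [MeasureSpace α] (p : ℝ≥0∞) (w : α → ℝ≥0∞) (A : Set α)
    {φ ψ : α → ℝ≥0∞} (h : ∀ x, φ x ≤ ψ x) : wNorm p w A φ ≤ wNorm p w A ψ := by
  unfold wNorm
  split_ifs
  · exact essSup_mono_ae (.of_forall fun x => mul_le_mul_left (h x) _)
  · gcongr
    exact h _

theorem wNorm_add_le {α : Type*} [MeasureSpace α] {p : ℝ≥0∞} (hp : 1 ≤ p) (hp' : p ≠ ∞)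
    {w : α → ℝ≥0∞} (hw : AEMeasurable w) (A : Set α) {φ ψ : α → ℝ≥0∞} (hφ : AEMeasurable φ)
    (hψ : AEMeasurable ψ) :
    wNorm p w A (fun x => φ x + ψ x) ≤ wNorm p w A φ + wNorm p w A ψ := by
  have h1 : 1 ≤ p.toReal := by
    rwa [← ENNReal.toReal_one, ENNReal.toReal_le_toReal ENNReal.one_ne_top hp']
  have h0 : 0 < p.toReal := by linarith
  have e : ∀ (φ : α → ℝ≥0∞) x, φ x ^ p.toReal * w x = (φ x * w x ^ (p.toReal)⁻¹) ^ p.toReal :=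
    fun φ x => by
      rw [ENNReal.mul_rpow_of_nonneg _ _ h0.le, ← ENNReal.rpow_mul, inv_mul_cancel₀ h0.ne',
        ENNReal.rpow_one]
  simp only [wNorm_of_ne_top hp', e φ, e ψ, e (fun x => φ x + ψ x), ← one_div]
  refine le_trans (le_of_eq ?_) (ENNReal.lintegral_Lp_add_le (μ := volume.restrict A)
    (hφ.mul (hw.pow_const _)).restrict (hψ.mul (hw.pow_const _)).restrict h1)
  simp only [Pi.add_apply, add_mul]

theorem wNorm_zero {α : Type*} [MeasureSpace α] {p : ℝ≥0∞} (hp : 0 < p) (hp' : p ≠ ∞)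
    (w : α → ℝ≥0∞) (A : Set α) : wNorm p w A (fun _ => 0) = 0 := by
  have h0 : 0 < p.toReal := ENNReal.toReal_pos hp.ne' hp'
  simp [wNorm_of_ne_top hp', h0]

theorem wNorm_sum_le {α ι : Type*} [MeasureSpace α] {p : ℝ≥0∞} (hp : 1 ≤ p) (hp' : p ≠ ∞)
    {w : α → ℝ≥0∞} (hw : AEMeasurable w) (A : Set α) (J : Finset ι) {φ : ι → α → ℝ≥0∞}
    (hφ : ∀ j, AEMeasurable (φ j)) :
    wNorm p w A (fun x => ∑ j ∈ J, φ j x) ≤ ∑ j ∈ J, wNorm p w A (φ j) := by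
  classical
  induction J using Finset.induction_on with
  | empty => simp [wNorm_zero (zero_lt_one.trans_le hp) hp']
  | insert a s ha ih =>
    simp only [Finset.sum_insert ha]
    refine (wNorm_add_le hp hp' hw A (hφ a) ?_).trans (by gcongr)
    exact Finset.aemeasurable_fun_sum _ fun j _ => hφ j

/-- Tested on ∑ ψ_j g_j with g_j near-extremal off B(0,s_j). A ball of radius r meets only those g_j
with s_j < r, so by Minkowski the norm on that ball is dominated by the step function in `hΨ`. -/
theorem sum_mul_le_associateNorm {n : ℕ} {p θ : ℝ≥0∞} (hp : 1 ≤ p) (hp' : p ≠ ∞)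
    {ω : ℝ → ℝ≥0∞} {v : RSpace n → ℝ≥0∞} (hv : IsWeight v)
    {f : RSpace n → EReal} (hf : AEMeasurable f) {ι : Type*} (J : Finset ι) (s : ι → ℝ)
    (ψ K : ι → ℝ≥0∞) (hψ : ∀ j ∈ J, ψ j ≠ ∞)
    (hK : ∀ j ∈ J, K j = 0 ∨ K j < dualNorm p v (Metric.ball 0 (s j))ᶜ f)
    (hΨ : wNorm θ 1 (Ioi (0 : ℝ)) (fun r => ω r * ∑ j ∈ J, if s j < r then ψ j else 0) ≤ 1) :
    ∑ j ∈ J, ψ j * K j ≤ associateNorm (LocalMorrey n p θ ω v) (morreyNorm p θ ω v) f := by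
  have hP : 0 < p.toReal := ENNReal.toReal_pos (zero_lt_one.trans_le hp).ne' hp'
  have habs : AEMeasurable (fun x => (f x).abs) := measurable_ereal_abs.comp_aemeasurable hf
  have hex : ∀ j, ∃ g : RSpace n → ℝ≥0∞, AEMeasurable g ∧
      (∀ x ∉ (Metric.ball (0 : RSpace n) (s j))ᶜ, g x = 0) ∧
      ∫⁻ x, g x ^ p.toReal * v x ≤ 1 ∧ (j ∈ J → K j ≤ ∫⁻ x, (f x).abs * g x) := fun j => by
    by_cases hj : j ∈ J ∧ K j ≠ 0
    · obtain ⟨g, h1, h2, h3, h4⟩ := exists_testFunction hp hp' hv habs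
        Metric.isOpen_ball.measurableSet.compl ((hK j hj.1).resolve_left hj.2)
      exact ⟨g, h1, h2, h3, fun _ => h4⟩
    -- No number lies strictly below a zero dual norm, so the indices with K_j = 0 take the zero
    -- function.
    · refine ⟨fun _ => 0, aemeasurable_const, fun _ _ => rfl, by simp [hP], fun hjJ => ?_⟩
      have : K j = 0 := by by_contra h; exact hj ⟨hjJ, h⟩
      simp [this]
  choose g hgm hgs hgn hgK using hex
  have hG : ∀ A : Set (RSpace n), wNorm p v A (fun x => ∑ j ∈ J, ψ j * g j x) ≤
      ∑ j ∈ J, wNorm p v A (fun x => ψ j * g j x) := fun A =>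
    wNorm_sum_le hp hp' hv.1 A J fun j => (hgm j).const_mul _
  have hG1 : ∀ (A : Set (RSpace n)) (j), wNorm p v A (fun x => ψ j * g j x) ≤ ψ j := fun A j => by
    rw [wNorm_of_ne_top hp', ENNReal.rpow_inv_le_iff hP]
    calc ∫⁻ x in A, (ψ j * g j x) ^ p.toReal * v x
        ≤ ∫⁻ x, (ψ j * g j x) ^ p.toReal * v x := setLIntegral_le_lintegral _ _
      _ = ∫⁻ x, ψ j ^ p.toReal * (g j x ^ p.toReal * v x) := by
          refine lintegral_congr fun x => ?_
          rw [ENNReal.mul_rpow_of_nonneg _ _ hP.le, mul_assoc]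
      _ = ψ j ^ p.toReal * ∫⁻ x, g j x ^ p.toReal * v x :=
          lintegral_const_mul'' _ (((hgm j).pow_const _).mul hv.1)
      _ ≤ ψ j ^ p.toReal * 1 := by gcongr; exact hgn j
      _ = _ := mul_one _
  have hGr : ∀ r, wNorm p v (Metric.ball 0 r) (fun x => ∑ j ∈ J, ψ j * g j x) ≤
      ∑ j ∈ J, if s j < r then ψ j else 0 := fun r => by
    refine (hG _).trans (Finset.sum_le_sum fun j _ => ?_)
    split_ifs with h
    · exact hG1 _ j
    · rw [wNorm_of_ne_top hp', setLIntegral_congr_fun (g := fun _ => 0) Metric.isOpen_ball.measurableSet]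
      · simp [hP]
      · intro x hx
        have : g j x = 0 := hgs j x (by
          rw [mem_compl_iff, not_not]
          exact Metric.ball_subset_ball (not_lt.1 h) hx)
        simp [this, hP]
  set γ : RSpace n → EReal := fun x => ((∑ j ∈ J, ψ j * g j x : ℝ≥0∞) : EReal) with hγ
  have hγabs : ∀ x, (γ x).abs = ∑ j ∈ J, ψ j * g j x := fun x => ereal_abs_coe_ennreal _
  have hsum : AEMeasurable fun x => ∑ j ∈ J, ψ j * g j x :=
    Finset.aemeasurable_fun_sum _ fun j _ => (hgm j).const_mul _
  have hN : morreyNorm p θ ω v γ ≤ 1 := by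
    refine le_trans (wNorm_mono _ _ _ fun r => ?_) hΨ
    simp only [hγabs]
    gcongr
    exact hGr r
  have hmem : γ ∈ LocalMorrey n p θ ω v := by
    refine ⟨hsum.coe_ereal_ennreal, fun A _ => ?_, hN.trans_lt ENNReal.one_lt_top⟩
    simp only [hγabs]
    refine lt_of_le_of_lt ((hG A).trans (Finset.sum_le_sum fun j _ => hG1 A j)) ?_
    exact ENNReal.sum_lt_top.2 fun j hj => (hψ j hj).lt_top
  calc ∑ j ∈ J, ψ j * K j ≤ ∑ j ∈ J, ψ j * ∫⁻ x, (f x).abs * g j x :=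
        Finset.sum_le_sum fun j hj => by gcongr; exact hgK j hj
    _ = ∑ j ∈ J, ∫⁻ x, ψ j * ((f x).abs * g j x) :=
        Finset.sum_congr rfl fun j _ => (lintegral_const_mul'' _ (habs.mul (hgm j))).symm
    _ = ∫⁻ x, ∑ j ∈ J, ψ j * ((f x).abs * g j x) :=
        (lintegral_finsetSum' _ fun j _ => (habs.mul (hgm j)).const_mul _).symm
    _ = ∫⁻ x, (f x * γ x).abs := by
        refine lintegral_congr fun x => ?_
        rw [EReal.abs_mul, hγabs, Finset.mul_sum]
        exact Finset.sum_congr rfl fun j _ => by ring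
    _ ≤ _ := le_iSup₂_of_le γ ⟨hmem, hN⟩ le_rfl

theorem exists_sum_ite_le (J : Finset ℤ) (s : ℤ → ℝ) (ψ : ℤ → ℝ≥0∞) (r : ℝ) :
    (∑ j ∈ J, if s j < r then ψ j else 0) = 0 ∨
      ∃ k ∈ J, s k < r ∧ (∑ j ∈ J, if s j < r then ψ j else 0) ≤ ∑ j ∈ J with j ≤ k, ψ j := by
  by_cases h : (J.filter fun j => s j < r).Nonempty
  · refine Or.inr ⟨_, (Finset.mem_filter.1 (Finset.max'_mem _ h)).1,
      (Finset.mem_filter.1 (Finset.max'_mem _ h)).2, ?_⟩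
    rw [← Finset.sum_filter]
    refine Finset.sum_le_sum_of_subset fun j hj => ?_
    exact Finset.mem_filter.2 ⟨(Finset.mem_filter.1 hj).1, Finset.le_max' _ _ hj⟩
  · left
    rw [← Finset.sum_filter, Finset.not_nonempty_iff_eq_empty.1 h, Finset.sum_empty]

/-- At each r the step function is at most the partial sum up to the largest k with s_k < r. Summing
over all such k overcounts, but replaces the integral by tail norms and needs no ordering of the
s_j. -/
theorem wNorm_step_le_one {θ : ℝ≥0∞} (hθ : 0 < θ) (hθ' : θ ≠ ∞) {ω : ℝ → ℝ≥0∞}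
    (hω : AEMeasurable ω (volume.restrict (Ioi 0))) (J : Finset ℤ) (s : ℤ → ℝ) (ψ : ℤ → ℝ≥0∞)
    (h : ∑ k ∈ J, (tailNorm θ ω (s k) * ∑ j ∈ J with j ≤ k, ψ j) ^ θ.toReal ≤ 1) :
    wNorm θ 1 (Ioi (0 : ℝ)) (fun r => ω r * ∑ j ∈ J, if s j < r then ψ j else 0) ≤ 1 := by
  have hpos : 0 < θ.toReal := ENNReal.toReal_pos hθ.ne' hθ'
  rw [wNorm_of_ne_top hθ', ENNReal.rpow_inv_le_iff hpos, ENNReal.one_rpow]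
  refine le_trans ?_ h
  have hT : ∀ k, tailNorm θ ω (s k) ^ θ.toReal = ∫⁻ r in Ioi 0, (Ioi (s k)).indicator
      (fun r => ω r ^ θ.toReal) r := fun k => by
    rw [tailNorm, wNorm_of_ne_top hθ', ENNReal.rpow_inv_rpow hpos.ne',
      lintegral_indicator measurableSet_Ioi, Measure.restrict_restrict measurableSet_Ioi,
      Ioi_inter_Ioi]
    simp
  calc ∫⁻ r in Ioi 0, (ω r * ∑ j ∈ J, if s j < r then ψ j else 0) ^ θ.toReal * (1 : ℝ → ℝ≥0∞) r
      ≤ ∫⁻ r in Ioi 0, ∑ k ∈ J, (Ioi (s k)).indicator (fun r => ω r ^ θ.toReal) r *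
          (∑ j ∈ J with j ≤ k, ψ j) ^ θ.toReal := by
        refine lintegral_mono fun r => ?_
        rw [Pi.one_apply, mul_one]
        rcases exists_sum_ite_le J s ψ r with h0 | ⟨k, hk, hkr, hle⟩
        · rw [h0, mul_zero, ENNReal.zero_rpow_of_pos hpos]; exact zero_le
        · refine le_trans ?_ (Finset.single_le_sum (f := fun k =>
            (Ioi (s k)).indicator (fun r => ω r ^ θ.toReal) r *
              (∑ j ∈ J with j ≤ k, ψ j) ^ θ.toReal) (fun _ _ => zero_le) hk)
          simp only
          rw [indicator_of_mem (by exact hkr), ← ENNReal.mul_rpow_of_nonneg _ _ hpos.le]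
          gcongr
    _ = ∑ k ∈ J, (∫⁻ r in Ioi 0, (Ioi (s k)).indicator (fun r => ω r ^ θ.toReal) r) *
          (∑ j ∈ J with j ≤ k, ψ j) ^ θ.toReal := by
        rw [lintegral_finsetSum' _ fun k _ =>
          ((hω.pow_const _).indicator measurableSet_Ioi).mul_const _]
        exact Finset.sum_congr rfl fun k _ =>
          lintegral_mul_const'' _ ((hω.pow_const _).indicator measurableSet_Ioi)
    _ = _ := Finset.sum_congr rfl fun k _ => by
        rw [← hT, ENNReal.mul_rpow_of_nonneg _ _ hpos.le]

theorem wNorm_top_step_le_one (ω : ℝ → ℝ≥0∞) (J : Finset ℤ) (s : ℤ → ℝ) (ψ : ℤ → ℝ≥0∞)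
    (h : ∀ k ∈ J, tailNorm ∞ ω (s k) * ∑ j ∈ J with j ≤ k, ψ j ≤ 1) :
    wNorm ∞ 1 (Ioi (0 : ℝ)) (fun r => ω r * ∑ j ∈ J, if s j < r then ψ j else 0) ≤ 1 := by
  rw [wNorm_top]
  refine essSup_le_of_ae_le _ ?_
  have hT : ∀ k, ∀ᵐ r ∂(volume.restrict (Ioi (0 : ℝ))), s k < r → ω r ≤ tailNorm ∞ ω (s k) :=
    fun k => by
      have h1 := ENNReal.ae_le_essSup (μ := volume.restrict (Ioi (max (s k) 0)))
        (fun x => ω x * (1 : ℝ → ℝ≥0∞) x)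
      rw [ae_restrict_iff' measurableSet_Ioi] at h1 ⊢
      filter_upwards [h1] with r hr h0 hk
      rw [tailNorm, wNorm_top]
      simpa using hr (max_lt hk h0)
  filter_upwards [ae_all_iff.2 hT] with r hr
  rw [Pi.one_apply, mul_one]
  change _ ≤ (1 : ℝ≥0∞)
  rcases exists_sum_ite_le J s ψ r with h0 | ⟨k, hk, hkr, hle⟩
  · rw [h0, mul_zero]; exact zero_le
  · exact (mul_le_mul' (hr k hkr) hle).trans (h k hk)

theorem dualNorm_mul_inv_le_associateNorm {n : ℕ} {p θ : ℝ≥0∞} (hp : 1 ≤ p) (hp' : p ≠ ∞)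
    (hθ : 0 < θ) {ω : ℝ → ℝ≥0∞} (hω : OmegaClass θ ω) {v : RSpace n → ℝ≥0∞} (hv : IsWeight v)
    {f : RSpace n → EReal} (hf : AEMeasurable f) (t : ℝ) :
    dualNorm p v (Metric.ball 0 t)ᶜ f * (tailNorm θ ω t)⁻¹ ≤
      associateNorm (LocalMorrey n p θ ω v) (morreyNorm p θ ω v) f := by
  by_cases hT : tailNorm θ ω t = ∞
  · simp [hT]
  have h0 : tailNorm θ ω t ≠ 0 := (hω.pos t).ne'
  rw [← div_eq_mul_inv, ENNReal.div_le_iff h0 hT]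
  refine le_of_forall_lt fun K hK => ?_
  obtain ⟨K', hKK', hK'⟩ := exists_between hK
  have h1 : tailNorm θ ω t * (tailNorm θ ω t)⁻¹ ≤ 1 := ENNReal.mul_inv_le_one _
  have key := sum_mul_le_associateNorm (θ := θ) (ω := ω) hp hp' hv hf {(0 : ℤ)} (fun _ => t)
    (fun _ => (tailNorm θ ω t)⁻¹) (fun _ => K') (fun _ _ => ENNReal.inv_ne_top.2 h0)
    (fun _ _ => Or.inr hK') (by
      by_cases hθ' : θ = ∞
      · subst hθ'
        exact wNorm_top_step_le_one _ _ _ _ (by simp [Finset.filter_singleton, h1])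
      · refine wNorm_step_le_one hθ hθ' hω.1 _ _ _ ?_
        simpa [Finset.filter_singleton] using ENNReal.rpow_le_one h1 ENNReal.toReal_nonneg)
  simp only [Finset.sum_singleton] at key
  refine hKK'.trans_le ?_
  rw [mul_comm, ← div_eq_mul_inv, ENNReal.div_le_iff h0 hT] at key
  exact key

/-! ### Lower bound for θ > 1: dyadic discretization and duality -/

/-- The one-sided geometric sequence `i ↦ r ^ i` for `i ≥ 0`, extended by zero to `ℤ`. -/
noncomputable def geomWeight (r : ℝ≥0∞) (i : ℤ) : ℝ≥0∞ := if 0 ≤ i then r ^ i.toNat else 0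

theorem tsum_geomWeight (r : ℝ≥0∞) : ∑' i, geomWeight r i = (1 - r)⁻¹ := by
  rw [← ENNReal.tsum_geometric, ← Function.Injective.tsum_eq (f := geomWeight r)
    (g := ((↑) : ℕ → ℤ)) Nat.cast_injective]
  · simp [geomWeight]
  · intro i hi
    by_cases h : 0 ≤ i
    · exact ⟨i.toNat, Int.toNat_of_nonneg h⟩
    · simp [geomWeight, h] at hi

theorem sum_geomWeight_sub_le (r : ℝ≥0∞) (J : Finset ℤ) (k : ℤ) :
    ∑ j ∈ J, geomWeight r (k - j) ≤ (1 - r)⁻¹ :=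
  (ENNReal.sum_le_tsum _).trans_eq
    ((Equiv.tsum_eq (Equiv.subLeft k) (geomWeight r)).trans (tsum_geomWeight r))

theorem sum_geomWeight_sub_le' (r : ℝ≥0∞) (J : Finset ℤ) (j : ℤ) :
    ∑ k ∈ J, geomWeight r (k - j) ≤ (1 - r)⁻¹ :=
  (ENNReal.sum_le_tsum _).trans_eq
    ((Equiv.tsum_eq (Equiv.subRight j) (geomWeight r)).trans (tsum_geomWeight r))

/-- Young's inequality for convolution with a summable sequence: weighted Hölder in j, then exchange
of the two sums. -/
theorem sum_rpow_sum_geomWeight_le {t : ℝ} (ht : 1 ≤ t) (r : ℝ≥0∞) (J : Finset ℤ)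
    (b : ℤ → ℝ≥0∞) :
    ∑ k ∈ J, (∑ j ∈ J, geomWeight r (k - j) * b j) ^ t ≤ ((1 - r)⁻¹) ^ t * ∑ j ∈ J, b j ^ t := by
  have ht0 : 0 < t := by linarith
  set κ := (1 - r)⁻¹
  calc ∑ k ∈ J, (∑ j ∈ J, geomWeight r (k - j) * b j) ^ t
      ≤ ∑ k ∈ J, κ ^ (t - 1) * ∑ j ∈ J, geomWeight r (k - j) * b j ^ t := by
        refine Finset.sum_le_sum fun k _ => ?_
        calc _ ≤ ((∑ j ∈ J, geomWeight r (k - j)) ^ (1 - t⁻¹) *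
              (∑ j ∈ J, geomWeight r (k - j) * b j ^ t) ^ t⁻¹) ^ t := by
              gcongr
              exact ENNReal.inner_le_weight_mul_Lp_of_nonneg J ht _ _
          _ = (∑ j ∈ J, geomWeight r (k - j)) ^ (t - 1) *
              ∑ j ∈ J, geomWeight r (k - j) * b j ^ t := by
              rw [ENNReal.mul_rpow_of_nonneg _ _ ht0.le, ← ENNReal.rpow_mul,
                ENNReal.rpow_inv_rpow ht0.ne', sub_mul, inv_mul_cancel₀ ht0.ne', one_mul]
          _ ≤ _ := by
              gcongr
              exact sum_geomWeight_sub_le r J k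
    _ = κ ^ (t - 1) * ∑ j ∈ J, (∑ k ∈ J, geomWeight r (k - j)) * b j ^ t := by
        rw [← Finset.mul_sum, Finset.sum_comm]
        simp_rw [Finset.sum_mul]
    _ ≤ κ ^ (t - 1) * ∑ j ∈ J, κ * b j ^ t := by
        gcongr
        exact sum_geomWeight_sub_le' r J _
    _ = _ := by
        rw [← Finset.mul_sum, ← mul_assoc]
        congr 1
        nth_rewrite 2 [← ENNReal.rpow_one κ]
        rw [← ENNReal.rpow_add_of_nonneg _ _ (by linarith) zero_le_one, sub_add_cancel]

/-- The left side is the q-th power of the ℓ^q norm of F(s_j) 2^{j/q}. It is tested against b in the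
unit ball of ℓ^θ, using the coefficients 2^{j/q} b_j divided by the sum κ of the geometric series.
-/
theorem finsetSum_rpow_le_associateNorm {n : ℕ} {p θ : ℝ≥0∞} (hp : 1 ≤ p) (hp' : p ≠ ∞)
    (hθ : 1 < θ) {ω : ℝ → ℝ≥0∞} (hω : OmegaClass θ ω) {v : RSpace n → ℝ≥0∞} (hv : IsWeight v)
    {f : RSpace n → EReal} (hf : AEMeasurable f) {q : ℝ} (hq : q = θ.conjExponent.toReal)
    (hq1 : 1 ≤ q) (J : Finset ℤ) (s : ℤ → ℝ)
    (hs : ∀ j ∈ J, (2 : ℝ≥0∞) ^ j ≤ tailNorm θ ω (s j) ^ (-q))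
    (hF : ∀ j ∈ J, dualNorm p v (Metric.ball 0 (s j))ᶜ f ≠ ∞) :
    ∑ j ∈ J, dualNorm p v (Metric.ball 0 (s j))ᶜ f ^ q * 2 ^ j ≤
      (2 * (1 - (2 : ℝ≥0∞) ^ (-q⁻¹))⁻¹ *
        associateNorm (LocalMorrey n p θ ω v) (morreyNorm p θ ω v) f) ^ q := by
  have hq0 : 0 < q := by linarith
  set M := associateNorm (LocalMorrey n p θ ω v) (morreyNorm p θ ω v) f
  set F : ℤ → ℝ≥0∞ := fun j => dualNorm p v (Metric.ball 0 (s j))ᶜ f with hFdef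
  set r : ℝ≥0∞ := 2 ^ (-q⁻¹) with hr
  have hr1 : r < 1 := ENNReal.rpow_lt_one_of_one_lt_of_neg ENNReal.one_lt_two (by simpa using hq0)
  set κ := (1 - r)⁻¹ with hκ
  have hκ0 : κ ≠ 0 := ENNReal.inv_ne_zero.2 (ENNReal.sub_ne_top ENNReal.one_ne_top)
  have hκ1 : κ ≠ ∞ := ENNReal.inv_ne_top.2 (tsub_pos_of_lt hr1).ne'
  set β : ℤ → ℝ≥0∞ := fun j => (2 : ℝ≥0∞) ^ ((j : ℝ) * q⁻¹) with hβ
  have h20 : (2 : ℝ≥0∞) ≠ 0 := by norm_num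
  have h2t : (2 : ℝ≥0∞) ≠ ∞ := by norm_num
  have hβt : ∀ j, β j ≠ ∞ := fun j => ENNReal.rpow_ne_top_of_ne_zero h20 h2t
  have hβq : ∀ j, β j ^ q = 2 ^ j := fun j => by
    rw [hβ]
    simp only
    rw [← ENNReal.rpow_mul, mul_assoc, inv_mul_cancel₀ hq0.ne', mul_one, ENNReal.rpow_intCast]
  have hTβ : ∀ j ∈ J, tailNorm θ ω (s j) * β j ≤ 1 := fun j hj => by
    rw [← ENNReal.rpow_le_rpow_iff hq0, ENNReal.mul_rpow_of_nonneg _ _ hq0.le, hβq,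
      ENNReal.one_rpow]
    calc _ ≤ tailNorm θ ω (s j) ^ q * tailNorm θ ω (s j) ^ (-q) := by gcongr; exact hs j hj
      _ ≤ 1 := by rw [ENNReal.rpow_neg]; exact ENNReal.mul_inv_le_one _
  -- Since T(s_k) ≤ 2^{-k/q}, the product is at most 2^{-(k-j)/q}.
  have hTw : ∀ k ∈ J, ∀ j, j ≤ k → tailNorm θ ω (s k) * β j ≤ geomWeight r (k - j) :=
    fun k hk j hjk => by
      have e : β j = β k * geomWeight r (k - j) := by
        rw [geomWeight, if_pos (sub_nonneg.2 hjk), hr, ← ENNReal.rpow_natCast, ← ENNReal.rpow_mul,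
          hβ]
        simp only
        rw [← ENNReal.rpow_add _ _ h20 h2t]
        congr 1
        have : (((k - j).toNat : ℕ) : ℝ) = (k : ℝ) - j := by
          have h := Int.toNat_of_nonneg (sub_nonneg.2 hjk)
          exact_mod_cast congrArg (Int.cast : ℤ → ℝ) h
        rw [this]; ring
      rw [e, ← mul_assoc]
      exact (mul_le_mul_left (hTβ k hk) _).trans (one_mul _).le
  have hTsum : ∀ (b : ℤ → ℝ≥0∞), ∀ k ∈ J, tailNorm θ ω (s k) *
      ∑ j ∈ J with j ≤ k, κ⁻¹ * (β j * b j) ≤ κ⁻¹ * ∑ j ∈ J, geomWeight r (k - j) * b j :=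
    fun b k hk => by
      rw [← Finset.mul_sum, mul_left_comm, Finset.mul_sum]
      gcongr
      refine (Finset.sum_le_sum fun j hj => ?_).trans
        (Finset.sum_le_sum_of_subset (Finset.filter_subset (fun j => j ≤ k) J))
      rw [← mul_assoc]
      gcongr
      exact hTw k hk j (Finset.mem_filter.1 hj).2
  have main : ∀ b : ℤ → ℝ≥0, (θ = ∞ → ∀ j ∈ J, b j ≤ 1) →
      (θ ≠ ∞ → ∑ j ∈ J, (b j : ℝ≥0∞) ^ θ.toReal ≤ 1) →
      ∑ j ∈ J, F j * β j * b j ≤ 2 * κ * M := by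
    intro b hb1 hb2
    have key := sum_mul_le_associateNorm (θ := θ) (ω := ω) hp hp' hv hf J s
      -- Halving F_j provides the strict inequality required of K_j and costs the factor 2 in the
      -- constant.
      (fun j => κ⁻¹ * (β j * b j)) (fun j => F j / 2)
      (fun j _ => ENNReal.mul_ne_top (ENNReal.inv_ne_top.2 hκ0)
        (ENNReal.mul_ne_top (hβt j) ENNReal.coe_ne_top))
      (fun j hj => by
        by_cases h0 : F j = 0
        · left; simp [h0]
        · right; exact ENNReal.half_lt_self h0 (hF j hj)) ?_
    · calc ∑ j ∈ J, F j * β j * b j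
          = ∑ j ∈ J, 2 * κ * (κ⁻¹ * (β j * b j) * (F j / 2)) := by
            refine Finset.sum_congr rfl fun j _ => ?_
            calc F j * β j * b j = (2 * (F j / 2)) * (κ * κ⁻¹) * β j * b j := by
                  rw [ENNReal.mul_div_cancel h20 h2t, ENNReal.mul_inv_cancel hκ0 hκ1, mul_one]
              _ = _ := by ring
        _ = 2 * κ * ∑ j ∈ J, κ⁻¹ * (β j * b j) * (F j / 2) := by rw [Finset.mul_sum]
        _ ≤ 2 * κ * M := by gcongr
    · by_cases hθ' : θ = ∞
      · subst hθ'
        refine wNorm_top_step_le_one _ _ _ _ fun k hk =>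
          (hTsum (fun j => b j) k hk).trans ?_
        calc κ⁻¹ * ∑ j ∈ J, geomWeight r (k - j) * b j
            ≤ κ⁻¹ * ∑ j ∈ J, geomWeight r (k - j) * 1 := by
              gcongr with j hj
              exact_mod_cast hb1 rfl j hj
          _ ≤ κ⁻¹ * κ := by
              gcongr
              simp only [mul_one]
              exact sum_geomWeight_sub_le r J k
          _ ≤ 1 := ENNReal.inv_mul_le_one _
      · have ht1 : 1 ≤ θ.toReal := by
          rw [← ENNReal.toReal_one, ENNReal.toReal_le_toReal ENNReal.one_ne_top hθ']; exact hθ.le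
        refine wNorm_step_le_one (zero_lt_one.trans hθ) hθ' hω.1 _ _ _ ?_
        calc _ ≤ ∑ k ∈ J, (κ⁻¹ * ∑ j ∈ J, geomWeight r (k - j) * b j) ^ θ.toReal := by
              exact Finset.sum_le_sum fun k hk =>
                ENNReal.rpow_le_rpow (hTsum (fun j => b j) k hk) (by linarith)
          _ = (κ⁻¹) ^ θ.toReal * ∑ k ∈ J, (∑ j ∈ J, geomWeight r (k - j) * b j) ^ θ.toReal := by
              rw [Finset.mul_sum]
              exact Finset.sum_congr rfl fun k _ => ENNReal.mul_rpow_of_nonneg _ _ (by linarith)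
          _ ≤ (κ⁻¹) ^ θ.toReal * (κ ^ θ.toReal * 1) := by
              gcongr
              refine (sum_rpow_sum_geomWeight_le ht1 r J _).trans ?_
              gcongr
              exact hb2 hθ'
          _ ≤ 1 := by
              rw [mul_one, ← ENNReal.mul_rpow_of_nonneg _ _ (by linarith),
                ENNReal.inv_mul_cancel hκ0 hκ1, ENNReal.one_rpow]
  rw [← ENNReal.rpow_inv_le_iff hq0]
  have ecoe : ∀ j ∈ J, F j * β j = (((F j * β j).toNNReal : ℝ≥0) : ℝ≥0∞) := fun j hj =>
    (ENNReal.coe_toNNReal (ENNReal.mul_ne_top (hF j hj) (hβt j))).symm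
  have e1 : ∑ j ∈ J, F j ^ q * 2 ^ j = ∑ j ∈ J, (F j * β j) ^ q :=
    Finset.sum_congr rfl fun j _ => by rw [ENNReal.mul_rpow_of_nonneg _ _ hq0.le, hβq]
  change (∑ j ∈ J, F j ^ q * 2 ^ j) ^ q⁻¹ ≤ _
  rw [e1]
  by_cases hθ' : θ = ∞
  · have hq' : q = 1 := by rw [hq, hθ', conjExponent_top, ENNReal.toReal_one]
    have := main (fun _ => 1) (fun _ _ _ => le_rfl) (fun h => absurd hθ' h)
    rw [hq']
    simpa using this
  · have hc : q.HolderConjugate θ.toReal := hq ▸ (holderConjugate_toReal hθ hθ').symm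
    -- An extremal b for ℓ^q–ℓ^θ duality.
    obtain ⟨b, hb, hbe⟩ := (NNReal.isGreatest_Lp J (fun j => (F j * β j).toNNReal) hc).1
    have ht0 : 0 ≤ θ.toReal := ENNReal.toReal_nonneg
    have := main b (fun h => absurd h hθ') (fun _ => by
      simp_rw [← ENNReal.coe_rpow_of_nonneg _ ht0]
      exact_mod_cast hb)
    refine le_trans (le_of_eq ?_) this
    have hbe' := congrArg (fun x : ℝ≥0 => (x : ℝ≥0∞)) hbe
    simp only [ENNReal.ofNNReal_finsetSum, ENNReal.coe_mul] at hbe'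
    have e2 : ∑ j ∈ J, F j * β j * b j = ∑ j ∈ J, ((F j * β j).toNNReal : ℝ≥0∞) * b j :=
      Finset.sum_congr rfl fun j hj => by rw [← ecoe j hj]
    rw [e2, hbe', one_div, ENNReal.coe_rpow_of_nonneg _ (inv_nonneg.2 hq0.le),
      ENNReal.ofNNReal_finsetSum]
    congr 1
    refine Finset.sum_congr rfl fun j hj => ?_
    rw [ENNReal.coe_rpow_of_nonneg _ hq0.le, ← ecoe j hj]

theorem dualNorm_compl_ball_antitone {n : ℕ} (p : ℝ≥0∞) (v : RSpace n → ℝ≥0∞)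
    (f : RSpace n → EReal) : Antitone fun t => dualNorm p v (Metric.ball 0 t)ᶜ f := fun _ _ h =>
  wNorm_mono_set _ _ (compl_subset_compl.2 (Metric.ball_subset_ball h)) _

/-- On the piece where 2^j ≤ T^{-q} < 2^{j+1}, F is at most its value at the infimum s_j and the
Λ-mass is at most 2^{j+1}, which gives the leading factor 2. -/
theorem lintegral_dualNorm_le_associateNorm {n : ℕ} {p θ : ℝ≥0∞} (hp : 1 ≤ p) (hp' : p ≠ ∞)
    (hθ : 1 < θ) (hθ0 : 0 < θ) {ω : ℝ → ℝ≥0∞} (hω : OmegaClass θ ω) {v : RSpace n → ℝ≥0∞}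
    (hv : IsWeight v) {f : RSpace n → EReal} (hf : AEMeasurable f)
    (hq0 : 0 < θ.conjExponent.toReal) (hq1 : 1 ≤ θ.conjExponent.toReal) :
    ∫⁻ t, dualNorm p v (Metric.ball 0 t)ᶜ f ^ θ.conjExponent.toReal ∂(tailMeasure hθ0 hω hq0) ≤
      2 * (2 * (1 - (2 : ℝ≥0∞) ^ (-(θ.conjExponent.toReal)⁻¹))⁻¹ *
        associateNorm (LocalMorrey n p θ ω v) (morreyNorm p θ ω v) f) ^ θ.conjExponent.toReal := by
  set q := θ.conjExponent.toReal with hq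
  set Λ := tailMeasure hθ0 hω hq0 with hΛ
  set M := associateNorm (LocalMorrey n p θ ω v) (morreyNorm p θ ω v) f with hM
  set C := 2 * (1 - (2 : ℝ≥0∞) ^ (-q⁻¹))⁻¹ with hC
  have hC0 : C ≠ 0 := mul_ne_zero (by norm_num)
    (ENNReal.inv_ne_zero.2 (ENNReal.sub_ne_top ENNReal.one_ne_top))
  by_cases hMt : M = ∞
  · rw [hMt, ENNReal.mul_top hC0, ENNReal.top_rpow_of_pos hq0, ENNReal.mul_top (by norm_num)]
    exact le_top
  set F : ℝ → ℝ≥0∞ := fun t => dualNorm p v (Metric.ball 0 t)ᶜ f with hF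
  have hFanti : Antitone F := dualNorm_compl_ball_antitone p v f
  have hTanti := tailNorm_antitone θ ω
  set L : ℝ → ℝ≥0∞ := fun t => tailNorm θ ω t ^ (-q) with hL
  have hLmono : Monotone L := fun s t hst => by
    simp only [hL, ENNReal.rpow_neg, ENNReal.inv_le_inv]
    exact ENNReal.rpow_le_rpow (hTanti hst) hq0.le
  have hLt : ∀ t, L t ≠ ∞ := hω.rpow_neg_ne_top hq0
  have hΛL : ∀ t, 0 ≤ t → Λ (Iic t) = L t := fun t ht => tailMeasure_Iic hθ0 hω hq0 ht
  have hFt : ∀ t, L t ≠ 0 → F t ≠ ∞ := fun t ht hFt => by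
    have h1 := dualNorm_mul_inv_le_associateNorm (n := n) hp hp' hθ0 hω hv hf t
    have hT : tailNorm θ ω t ≠ ∞ := fun h => ht (by simp [hL, h, hq0])
    change F t * _ ≤ M at h1
    rw [hFt, ENNReal.top_mul (ENNReal.inv_ne_zero.2 hT), top_le_iff] at h1
    exact hMt h1
  set P : ℤ → Set ℝ := fun j => {t | 0 ≤ t ∧ L t ∈ Ico ((2 : ℝ≥0∞) ^ j) (2 ^ (j + 1))} with hP
  set s : ℤ → ℝ := fun j => sInf (P j) with hs
  have hPm : ∀ j, MeasurableSet (P j) := fun j =>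
    measurableSet_Ici.inter (hLmono.measurable measurableSet_Ico)
  have hbdd : ∀ j, BddBelow (P j) := fun j => ⟨0, fun t ht => ht.1⟩
  -- The infimum need not belong to the piece; right continuity of T passes the lower bound on to
  -- it.
  have hs2 : ∀ j, (P j).Nonempty → (2 : ℝ≥0∞) ^ j ≤ L (s j) := fun j hj => by
    have ht : Tendsto L (𝓝[>] (s j)) (𝓝 (L (s j))) :=
      (ENNReal.continuous_rpow_const.tendsto _).comp (tailNorm_tendsto_nhdsGT hθ0 ω (s j))
    refine ge_of_tendsto ht ?_
    filter_upwards [self_mem_nhdsWithin] with t ht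
    obtain ⟨x, hx, hxt⟩ := exists_lt_of_csInf_lt hj ht
    exact hx.2.1.trans (hLmono hxt.le)
  have h2pos : ∀ j : ℤ, (2 : ℝ≥0∞) ^ j ≠ 0 := fun j =>
    (ENNReal.zpow_pos (by norm_num) (by norm_num) j).ne'
  have hΛP : ∀ j, Λ (P j) ≤ 2 ^ (j + 1) := fun j => by
    refine (measure_mono fun t ht => ?_).trans (measure_setOf_measure_Iic_lt_le Λ _)
    change Λ (Iic t) < _
    rw [hΛL t ht.1]
    exact ht.2.2
  -- These points, where T is infinite, belong to no dyadic piece.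
  have hzero : Λ {t | 0 ≤ t ∧ L t = 0} = 0 := by
    refine le_antisymm (le_of_forall_gt_imp_ge_of_dense fun ε hε => ?_) zero_le
    refine (measure_mono fun t ht => ?_).trans (measure_setOf_measure_Iic_lt_le Λ ε)
    change Λ (Iic t) < _
    rw [hΛL t ht.1, ht.2]
    exact hε
  have hae : ∀ᵐ t ∂Λ, t ∈ ⋃ j, P j := by
    have h1 : ∀ᵐ t ∂Λ, 0 ≤ t := ae_nonneg_of_measure_Iio_zero (tailMeasure_Iio_zero hθ0 hω hq0)
    have h2 : ∀ᵐ t ∂Λ, ¬ (0 ≤ t ∧ L t = 0) := by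
      rw [ae_iff]; simpa using hzero
    filter_upwards [h1, h2] with t ht0 ht
    obtain ⟨j, hj⟩ := ENNReal.exists_mem_Ico_zpow (fun h => ht ⟨ht0, h⟩) (hLt t)
      (ENNReal.one_lt_two) (by norm_num)
    exact mem_iUnion.2 ⟨j, ht0, hj⟩
  set a : ℤ → ℝ≥0∞ := fun j => ∫⁻ t in P j, F t ^ q ∂Λ with ha
  have ha0 : ∀ j, ¬ (P j).Nonempty → a j = 0 := fun j hj => by
    simp [ha, not_nonempty_iff_eq_empty.1 hj]
  have ha1 : ∀ j, a j ≤ 2 * (F (s j) ^ q * 2 ^ j) := fun j => by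
    calc a j ≤ ∫⁻ _ in P j, F (s j) ^ q ∂Λ := setLIntegral_mono' (hPm j) fun t ht =>
          ENNReal.rpow_le_rpow (hFanti (csInf_le (hbdd j) ht)) hq0.le
      _ = F (s j) ^ q * Λ (P j) := setLIntegral_const _ _
      _ ≤ F (s j) ^ q * 2 ^ (j + 1) := by gcongr; exact hΛP j
      _ = 2 * (F (s j) ^ q * 2 ^ j) := by
          rw [ENNReal.zpow_add (by norm_num) (by norm_num), zpow_one]; ring
  calc ∫⁻ t, F t ^ q ∂Λ = ∫⁻ t in ⋃ j, P j, F t ^ q ∂Λ := by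
        rw [Measure.restrict_eq_self_of_ae_mem hae]
    _ ≤ ∑' j, a j := lintegral_iUnion_le _ _
    _ ≤ 2 * (C * M) ^ q := by
        rw [ENNReal.tsum_eq_iSup_sum]
        refine iSup_le fun J => ?_
        classical
        calc ∑ j ∈ J, a j = ∑ j ∈ J with (P j).Nonempty, a j := by
              rw [Finset.sum_filter]
              refine Finset.sum_congr rfl fun j _ => ?_
              split_ifs with h
              · rfl
              · exact ha0 j h
          _ ≤ ∑ j ∈ J with (P j).Nonempty, 2 * (F (s j) ^ q * 2 ^ j) :=
              Finset.sum_le_sum fun j _ => ha1 j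
          _ = 2 * ∑ j ∈ J with (P j).Nonempty, F (s j) ^ q * 2 ^ j := by rw [Finset.mul_sum]
          _ ≤ _ := by
              gcongr
              refine finsetSum_rpow_le_associateNorm hp hp' hθ hω hv hf hq hq1 _ s
                (fun j hj => hs2 j (Finset.mem_filter.1 hj).2)
                (fun j hj => hFt _ fun h => ?_)
              have := hs2 j (Finset.mem_filter.1 hj).2
              rw [h] at this
              exact h2pos j (le_antisymm this zero_le)

/-! ### Upper bound: passage to the radial distribution of |fg| -/

/-- The distribution of `|x|` under the measure `h(x) dx`. -/
noncomputable def radialMeasure {n : ℕ} (h : RSpace n → ℝ≥0∞) : Measure ℝ :=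
  (volume.withDensity h).map norm

instance {n : ℕ} (h : RSpace n → ℝ≥0∞) : SFinite (radialMeasure h) := by
  unfold radialMeasure; infer_instance

theorem radialMeasure_apply {n : ℕ} (h : RSpace n → ℝ≥0∞) {S : Set ℝ} (hS : MeasurableSet S) :
    radialMeasure h S = ∫⁻ x in norm ⁻¹' S, h x := by
  rw [radialMeasure, Measure.map_apply measurable_norm hS, withDensity_apply _ (measurable_norm hS)]

theorem radialMeasure_univ {n : ℕ} (h : RSpace n → ℝ≥0∞) : radialMeasure h univ = ∫⁻ x, h x := by
  rw [radialMeasure_apply h MeasurableSet.univ, preimage_univ, Measure.restrict_univ]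

theorem radialMeasure_Iic_zero {n : ℕ} (hn : 1 ≤ n) (h : RSpace n → ℝ≥0∞) :
    radialMeasure h (Iic 0) = 0 := by
  have : Nonempty (Fin n) := ⟨⟨0, hn⟩⟩
  rw [radialMeasure_apply h measurableSet_Iic]
  have : (norm ⁻¹' Iic 0 : Set (RSpace n)) = {0} := by ext x; simp
  rw [this]
  exact setLIntegral_measure_zero _ _ (measure_singleton _)

theorem radialMeasure_Ico_le {n : ℕ} {p : ℝ≥0∞} (hp : 1 ≤ p) (hp' : p ≠ ∞)
    {v : RSpace n → ℝ≥0∞} (hv : IsWeight v) {f g : RSpace n → EReal} (hf : AEMeasurable f)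
    (hg : AEMeasurable g) (s r : ℝ) :
    radialMeasure (fun x => (f x * g x).abs) (Ico s r) ≤ dualNorm p v (Metric.ball 0 s)ᶜ f *
      wNorm p v (Metric.ball 0 r) fun x => (g x).abs := by
  rw [radialMeasure_apply _ measurableSet_Ico]
  have : (norm ⁻¹' Ico s r : Set (RSpace n)) = (Metric.ball 0 s)ᶜ ∩ Metric.ball 0 r := by
    ext x; simp
  rw [this]
  simp only [EReal.abs_mul]
  exact lintegral_mul_le_wNorm hp hp' hv (measurable_ereal_abs.comp_aemeasurable hf)
    (measurable_ereal_abs.comp_aemeasurable hg) _ _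

theorem wNorm_ball_monotone {n : ℕ} (p : ℝ≥0∞) (v φ : RSpace n → ℝ≥0∞) :
    Monotone fun r => wNorm p v (Metric.ball 0 r) φ := fun _ _ h =>
  wNorm_mono_set _ _ (Metric.ball_subset_ball h) _

/-- Complements of shrinking balls exhaust everything but the origin, a null set because n ≥ 1. This
extends bounds known for t > 0 to the endpoint 0, where Λ may have an atom. -/
theorem dualNorm_univ_le_of_forall_pos {n : ℕ} (hn : 1 ≤ n) {p : ℝ≥0∞} (hp : 1 ≤ p)
    (v : RSpace n → ℝ≥0∞) (f : RSpace n → EReal) {S : ℝ≥0∞}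
    (hS : ∀ t, 0 < t → dualNorm p v (Metric.ball 0 t)ᶜ f ≤ S) : dualNorm p v univ f ≤ S := by
  have : Nonempty (Fin n) := ⟨⟨0, hn⟩⟩
  have hU : (⋃ k : ℕ, (Metric.ball (0 : RSpace n) (1 / ((k : ℝ) + 1)))ᶜ) = {0}ᶜ := by
    ext x
    simp only [mem_iUnion, mem_compl_iff, mem_ball_zero_iff, not_lt, mem_singleton_iff]
    refine ⟨fun ⟨k, hk⟩ h => ?_, fun h => ?_⟩
    · rw [h, norm_zero] at hk
      exact absurd hk (not_le.2 (by positivity))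
    · obtain ⟨k, hk⟩ := exists_nat_one_div_lt (norm_pos_iff.2 h)
      exact ⟨k, hk.le⟩
  have hb : ∀ k : ℕ, dualNorm p v (Metric.ball (0 : RSpace n) (1 / ((k : ℝ) + 1)))ᶜ f ≤ S :=
    fun k => hS _ (by positivity)
  have huniv : (volume : Measure (RSpace n)).restrict univ =
      volume.restrict (⋃ k : ℕ, (Metric.ball (0 : RSpace n) (1 / ((k : ℝ) + 1)))ᶜ) := by
    rw [hU, Measure.restrict_univ, restrict_compl_singleton]
  unfold dualNorm at hb ⊢
  rcases hp.eq_or_lt with rfl | hp1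
  · simp only [conjExponent_one, wNorm_top] at hb ⊢
    rw [huniv]
    refine essSup_le_of_ae_le _ ((ae_restrict_iUnion_iff _ _).2 fun k => ?_)
    filter_upwards [ENNReal.ae_le_essSup
      (μ := volume.restrict (Metric.ball (0 : RSpace n) (1 / ((k : ℝ) + 1)))ᶜ)
      (fun x => (f x).abs * dualWeight 1 v x)] with x hx using hx.trans (hb k)
  · have hQ : 0 < p.conjExponent.toReal := ENNReal.toReal_pos
      (by simp [ENNReal.conjExponent]) (conjExponent_ne_top hp1)
    have hbm : ∀ k : ℕ, MeasurableSet (Metric.ball (0 : RSpace n) (1 / ((k : ℝ) + 1)))ᶜ :=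
      fun k => Metric.isOpen_ball.measurableSet.compl
    simp only [wNorm_of_ne_top (conjExponent_ne_top hp1), ENNReal.rpow_inv_le_iff hQ] at hb ⊢
    rw [huniv, ← withDensity_apply _ (MeasurableSet.iUnion hbm), Monotone.measure_iUnion]
    · refine iSup_le fun k => ?_
      rw [withDensity_apply _ (hbm k)]
      exact hb k
    · intro i j hij
      refine compl_subset_compl.2 (Metric.ball_subset_ball ?_)
      exact one_div_le_one_div_of_le (by positivity)
        (by exact_mod_cast Nat.succ_le_succ hij : (i : ℝ) + 1 ≤ j + 1)

/-- The measure `ω(r)^t dr` on `(0,∞)`. -/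
noncomputable def powerMeasure (ω : ℝ → ℝ≥0∞) (t : ℝ) : Measure ℝ :=
  (volume.restrict (Ioi 0)).withDensity fun r => ω r ^ t

instance (ω : ℝ → ℝ≥0∞) (t : ℝ) : SFinite (powerMeasure ω t) := by
  unfold powerMeasure; infer_instance

instance (ω : ℝ → ℝ≥0∞) (t : ℝ) : NullSingletonClass (powerMeasure ω t) :=
  ⟨fun _ => withDensity_absolutelyContinuous _ _ (measure_singleton _)⟩

theorem powerMeasure_Iic_zero (ω : ℝ → ℝ≥0∞) (t : ℝ) : powerMeasure ω t (Iic 0) = 0 := by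
  refine withDensity_absolutelyContinuous _ _ ?_
  rw [Measure.restrict_apply measurableSet_Iic, inter_comm, Ioi_inter_Iic, Ioc_self, measure_empty]

theorem powerMeasure_Ioi {θ : ℝ≥0∞} (hθ : 0 < θ) (hθ' : θ ≠ ∞) (ω : ℝ → ℝ≥0∞) {u : ℝ}
    (hu : 0 ≤ u) : powerMeasure ω θ.toReal (Ioi u) = tailNorm θ ω u ^ θ.toReal := by
  have hpos : 0 < θ.toReal := ENNReal.toReal_pos hθ.ne' hθ'
  rw [powerMeasure, withDensity_apply _ measurableSet_Ioi,
    Measure.restrict_restrict measurableSet_Ioi, Ioi_inter_Ioi, tailNorm, wNorm_of_ne_top hθ',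
    ENNReal.rpow_inv_rpow hpos.ne']
  simp [max_eq_left hu]

theorem powerMeasure_Ioi_ne {θ : ℝ≥0∞} (hθ : 0 < θ) (hθ' : θ ≠ ∞) {ω : ℝ → ℝ≥0∞}
    (hω : OmegaClass θ ω) {u : ℝ} (hu : 0 < u) :
    powerMeasure ω θ.toReal (Ioi u) ≠ 0 ∧ powerMeasure ω θ.toReal (Ioi u) ≠ ∞ := by
  rw [powerMeasure_Ioi hθ hθ' ω hu.le]
  exact ⟨(ENNReal.rpow_pos (hω.pos u) (hω.lt_top hu).ne).ne',
    ENNReal.rpow_ne_top_of_nonneg ENNReal.toReal_nonneg (hω.lt_top hu).ne⟩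

theorem lintegral_powerMeasure {n : ℕ} {p θ : ℝ≥0∞} (hθ : 0 < θ) (hθ' : θ ≠ ∞) {ω : ℝ → ℝ≥0∞}
    (hω : OmegaClass θ ω) (v : RSpace n → ℝ≥0∞) (g : RSpace n → EReal) :
    ∫⁻ r, wNorm p v (Metric.ball 0 r) (fun x => (g x).abs) ^ θ.toReal
      ∂(powerMeasure ω θ.toReal) = morreyNorm p θ ω v g ^ θ.toReal := by
  have hpos : 0 < θ.toReal := ENNReal.toReal_pos hθ.ne' hθ'
  rw [powerMeasure, lintegral_withDensity_eq_lintegral_mul₀ (hω.1.pow_const _)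
    ((wNorm_ball_monotone p v _).measurable.pow_const _).aemeasurable, morreyNorm,
    wNorm_of_ne_top hθ', ENNReal.rpow_inv_rpow hpos.ne']
  refine lintegral_congr fun r => ?_
  rw [Pi.mul_apply, ENNReal.mul_rpow_of_nonneg _ _ hpos.le, Pi.one_apply, mul_one]

theorem lintegral_le_of_le_one {n : ℕ} (hn : 1 ≤ n) {p θ : ℝ≥0∞} (hp : 1 ≤ p) (hp' : p ≠ ∞)
    (hθ : 0 < θ) (hθ1 : θ ≤ 1) {ω : ℝ → ℝ≥0∞} (hω : OmegaClass θ ω) {v : RSpace n → ℝ≥0∞}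
    (hv : IsWeight v) {f g : RSpace n → EReal} (hf : AEMeasurable f) (hg : AEMeasurable g)
    (hgN : morreyNorm p θ ω v g ≤ 1) :
    ∫⁻ x, (f x * g x).abs ≤ (2 : ℝ≥0∞) ^ (2 : ℝ) * 2 ^ (2 / θ.toReal) *
      ⨆ t ∈ Ioi (0 : ℝ), dualNorm p v (Metric.ball 0 t)ᶜ f * (tailNorm θ ω t)⁻¹ := by
  have hθ' : θ ≠ ∞ := (hθ1.trans_lt ENNReal.one_lt_top).ne
  have hpos : 0 < θ.toReal := ENNReal.toReal_pos hθ.ne' hθ'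
  set D := ⨆ t ∈ Ioi (0 : ℝ), dualNorm p v (Metric.ball 0 t)ᶜ f * (tailNorm θ ω t)⁻¹ with hD
  have hDt : ∀ t, 0 < t → dualNorm p v (Metric.ball 0 t)ᶜ f * (tailNorm θ ω t)⁻¹ ≤ D :=
    fun t ht => le_iSup₂_of_le t ht le_rfl
  have hΛ : ∀ s, 0 ≤ s → tailMeasure hθ hω one_pos (Iic s) = (tailNorm θ ω s)⁻¹ := fun s hs => by
    rw [tailMeasure_Iic hθ hω one_pos hs, ENNReal.rpow_neg_one]
  rw [← radialMeasure_univ]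
  refine (measure_univ_le_of_Ico_le_of_le_one hpos (ENNReal.toReal_mono ENNReal.one_ne_top hθ1)
    (tailMeasure_Iio_zero hθ hω one_pos)
    (fun s hs => ?_) (powerMeasure_Iic_zero ω θ.toReal)
    (fun u hu => powerMeasure_Ioi_ne hθ hθ' hω hu) (radialMeasure_Iic_zero hn _)
    (wNorm_ball_monotone p v _)
    (radialMeasure_Ico_le hp hp' hv hf hg) (D := D) (fun s hs => ?_)).trans ?_
  · rw [hΛ s hs, powerMeasure_Ioi hθ hθ' ω hs, ← ENNReal.rpow_mul, mul_neg,
      mul_inv_cancel₀ hpos.ne', ENNReal.rpow_neg_one]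
  · rw [hΛ s hs]
    rcases hs.eq_or_lt with rfl | hs
    · by_cases hT : tailNorm θ ω 0 = ∞
      · simp [hT]
      rw [← div_eq_mul_inv, ENNReal.div_le_iff (hω.pos 0).ne' hT, Metric.ball_zero, compl_empty]
      refine dualNorm_univ_le_of_forall_pos hn hp v f fun t ht => ?_
      have := hDt t ht
      rw [← div_eq_mul_inv, ENNReal.div_le_iff (hω.pos t).ne' (hω.lt_top ht).ne] at this
      refine this.trans ?_
      gcongr
      exact tailNorm_antitone θ ω ht.le
    · exact hDt s hs
  · gcongr
    rw [lintegral_powerMeasure hθ hθ' hω, ENNReal.rpow_rpow_inv hpos.ne']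
    exact (mul_le_mul_right hgN _).trans (mul_one _).le

theorem lintegral_le_of_one_lt_of_ne_top {n : ℕ} (hn : 1 ≤ n) {p θ : ℝ≥0∞} (hp : 1 ≤ p)
    (hp' : p ≠ ∞) (hθ : 0 < θ) (hθ1 : 1 < θ) (hθ' : θ ≠ ∞) {ω : ℝ → ℝ≥0∞} (hω : OmegaClass θ ω)
    {v : RSpace n → ℝ≥0∞} (hv : IsWeight v) {f g : RSpace n → EReal} (hf : AEMeasurable f)
    (hg : AEMeasurable g) (hgN : morreyNorm p θ ω v g ≤ 1) {q : ℝ}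
    (hq : q = θ.conjExponent.toReal) (hq0 : 0 < q) :
    ∫⁻ x, (f x * g x).abs ≤
      (2 : ℝ≥0∞) ^ (θ.toReal / q ^ 2 + 1) * 2 ^ (q / θ.toReal ^ 2 + 1) *
      (∫⁻ t, dualNorm p v (Metric.ball 0 t)ᶜ f ^ q ∂(tailMeasure hθ hω hq0)) ^ (1 / q) := by
  have hpos : 0 < θ.toReal := ENNReal.toReal_pos hθ.ne' hθ'
  rw [← radialMeasure_univ]
  refine (measure_univ_le_of_Ico_le (hq ▸ holderConjugate_toReal hθ1 hθ')
    (tailMeasure_Iio_zero hθ hω hq0)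
    (fun s hs => ?_) (powerMeasure_Iic_zero ω θ.toReal)
    (fun u hu => powerMeasure_Ioi_ne hθ hθ' hω hu) (radialMeasure_Iic_zero hn _)
    (dualNorm_compl_ball_antitone p v f) (wNorm_ball_monotone p v _)
    (radialMeasure_Ico_le hp hp' hv hf hg)).trans ?_
  · rw [tailMeasure_Iic hθ hω hq0 hs, powerMeasure_Ioi hθ hθ' ω hs, ← ENNReal.rpow_mul, mul_neg,
      mul_div_cancel₀ _ hpos.ne']
  · gcongr
    rw [lintegral_powerMeasure hθ hθ' hω, one_div θ.toReal, ENNReal.rpow_rpow_inv hpos.ne']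
    exact (mul_le_mul_right hgN _).trans (mul_one _).le

/-- For s > r, G(r) ω(s) ≤ G(s) ω(s), so the essential supremum over (r,∞) suffices. -/
theorem wNorm_ball_mul_tailNorm_le {n : ℕ} {p : ℝ≥0∞} (ω : ℝ → ℝ≥0∞) (v : RSpace n → ℝ≥0∞)
    (g : RSpace n → EReal) {r : ℝ} (hr : 0 ≤ r) :
    wNorm p v (Metric.ball 0 r) (fun x => (g x).abs) * tailNorm ∞ ω r ≤ morreyNorm p ∞ ω v g := by
  rw [tailNorm, morreyNorm, wNorm_top, wNorm_top, ← ENNReal.essSup_const_mul, max_eq_left hr]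
  refine le_trans (essSup_mono_ae ?_)
    (essSup_mono_measure' (Measure.restrict_mono_set _ (Ioi_subset_Ioi hr)))
  filter_upwards [ae_restrict_mem measurableSet_Ioi] with s hs
  rw [Pi.one_apply, mul_one, mul_one, mul_comm]
  gcongr
  exact wNorm_ball_monotone p v _ (le_of_lt hs)

theorem lintegral_le_of_top {n : ℕ} (hn : 1 ≤ n) {p : ℝ≥0∞} (hp : 1 ≤ p)
    (hp' : p ≠ ∞) {ω : ℝ → ℝ≥0∞} (hθ : 0 < (∞ : ℝ≥0∞)) (hω : OmegaClass ∞ ω)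
    {v : RSpace n → ℝ≥0∞} (hv : IsWeight v) {f g : RSpace n → EReal} (hf : AEMeasurable f)
    (hg : AEMeasurable g) (hgN : morreyNorm p ∞ ω v g ≤ 1) {q : ℝ} (hq : q = 1) (hq0 : 0 < q) :
    ∫⁻ x, (f x * g x).abs ≤ (2 : ℝ≥0∞) ^ (2 : ℝ) * 2 ^ (2 : ℝ) *
      (∫⁻ t, dualNorm p v (Metric.ball 0 t)ᶜ f ^ q ∂(tailMeasure hθ hω hq0)) ^ (1 / q) := by
  subst hq
  rw [← radialMeasure_univ]
  refine (measure_univ_le_of_Ico_le_of_mul_le (tailNorm_antitone ∞ ω)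
    (fun u hu => ⟨(hω.pos u).ne', (hω.lt_top hu).ne⟩) (fun u τ hτ => ?_)
    (tailMeasure_Iio_zero hθ hω hq0)
    (fun s hs => by rw [tailMeasure_Iic hθ hω hq0 hs, ENNReal.rpow_neg_one])
    (radialMeasure_Iic_zero hn _)
    (dualNorm_compl_ball_antitone p v f)
    (radialMeasure_Ico_le hp hp' hv hf hg) (N := 1) (fun r => ?_)).trans ?_
  · by_contra! h
    exact hτ.not_ge (tailNorm_le_of_forall_gt hθ ω u h)
  · rcases le_total 0 r with hr | hr
    · exact (wNorm_ball_mul_tailNorm_le ω v g hr).trans hgN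
    · have hp0 : 0 < p.toReal := ENNReal.toReal_pos (zero_lt_one.trans_le hp).ne' hp'
      simp [Metric.ball_eq_empty.2 hr, wNorm_of_ne_top hp', hp0]
  · simp

theorem exists_lintegral_le_tailMeasure {n : ℕ} (hn : 1 ≤ n) {p θ : ℝ≥0∞} (hp : 1 ≤ p)
    (hp' : p ≠ ∞) (hθ : 0 < θ) (hθ1 : 1 < θ) {ω : ℝ → ℝ≥0∞} (hω : OmegaClass θ ω)
    {v : RSpace n → ℝ≥0∞} (hv : IsWeight v) (hq0 : 0 < θ.conjExponent.toReal) :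
    ∃ C : ℝ≥0, 0 < C ∧ ∀ f g : RSpace n → EReal, AEMeasurable f → AEMeasurable g →
      morreyNorm p θ ω v g ≤ 1 → ∫⁻ x, (f x * g x).abs ≤
        C * (∫⁻ t, dualNorm p v (Metric.ball 0 t)ᶜ f ^ θ.conjExponent.toReal
          ∂(tailMeasure hθ hω hq0)) ^ (1 / θ.conjExponent.toReal) := by
  have h2 : ∀ x : ℝ, (((2 : ℝ≥0) ^ x : ℝ≥0) : ℝ≥0∞) = (2 : ℝ≥0∞) ^ x := fun x =>
    ENNReal.coe_rpow_of_ne_zero two_ne_zero x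
  by_cases hθ' : θ = ∞
  · subst hθ'
    refine ⟨2 ^ (2 : ℝ) * 2 ^ (2 : ℝ), by positivity, fun f g hf hg hgN => ?_⟩
    have hq : (∞ : ℝ≥0∞).conjExponent.toReal = 1 := by simp [conjExponent_top]
    rw [ENNReal.coe_mul, h2]
    exact lintegral_le_of_top hn hp hp' hθ hω hv hf hg hgN hq hq0
  · refine ⟨2 ^ (θ.toReal / θ.conjExponent.toReal ^ 2 + 1) *
      2 ^ (θ.conjExponent.toReal / θ.toReal ^ 2 + 1), by positivity, fun f g hf hg hgN => ?_⟩
    rw [ENNReal.coe_mul, h2, h2]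
    exact lintegral_le_of_one_lt_of_ne_top hn hp hp' hθ hθ1 hθ' hω hv hf hg hgN rfl hq0

end WeightedMorrey

/-! ### The two equivalences -/

theorem mainTheorem7 (n : ℕ) (hn : 1 ≤ n) (p θ : ℝ≥0∞) (hp : 1 ≤ p) (hp' : p < ∞) (hθ : 0 < θ)
    (ω : ℝ → ℝ≥0∞) (hω : OmegaClass θ ω) (v : RSpace n → ℝ≥0∞) (hv : IsWeight v) :
    (θ ≤ 1 → ∃ c C : ℝ≥0, 0 < c ∧ 0 < C ∧ ∀ f : RSpace n → EReal, AEMeasurable f →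
      c * (⨆ t ∈ Ioi (0 : ℝ), dualNorm p v (Metric.ball 0 t)ᶜ f * (tailNorm θ ω t)⁻¹)
          ≤ associateNorm (LocalMorrey n p θ ω v) (morreyNorm p θ ω v) f ∧
      associateNorm (LocalMorrey n p θ ω v) (morreyNorm p θ ω v) f
          ≤ C * ⨆ t ∈ Ioi (0 : ℝ), dualNorm p v (Metric.ball 0 t)ᶜ f * (tailNorm θ ω t)⁻¹) ∧
    (1 < θ → ∃ c C : ℝ≥0, 0 < c ∧ 0 < C ∧ ∀ f : RSpace n → EReal, AEMeasurable f →
      c * ((∫⁻ t in Ioi (0 : ℝ), dualNorm p v (Metric.ball 0 t)ᶜ f ^ θ.conjExponent.toReal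
              ∂(stieltjesMeasure hω)) ^ (1 / θ.conjExponent.toReal)
            + dualNorm p v univ f / wNorm θ 1 (Ioi (0 : ℝ)) ω)
          ≤ associateNorm (LocalMorrey n p θ ω v) (morreyNorm p θ ω v) f ∧
      associateNorm (LocalMorrey n p θ ω v) (morreyNorm p θ ω v) f
          ≤ C * ((∫⁻ t in Ioi (0 : ℝ), dualNorm p v (Metric.ball 0 t)ᶜ f ^ θ.conjExponent.toReal
              ∂(stieltjesMeasure hω)) ^ (1 / θ.conjExponent.toReal)
            + dualNorm p v univ f / wNorm θ 1 (Ioi (0 : ℝ)) ω)) := by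
  refine ⟨fun hθ1 => ?_, fun hθ1 => ?_⟩
  · refine ⟨1, 2 ^ (2 : ℝ) * 2 ^ (2 / θ.toReal), one_pos, by positivity, fun f hf => ⟨?_, ?_⟩⟩
    · rw [ENNReal.coe_one, one_mul]
      exact iSup₂_le fun t _ => dualNorm_mul_inv_le_associateNorm hp hp'.ne hθ hω hv hf t
    · refine iSup₂_le fun g hg => ?_
      rw [ENNReal.coe_mul, ENNReal.coe_rpow_of_ne_zero two_ne_zero,
        ENNReal.coe_rpow_of_ne_zero two_ne_zero]
      exact lintegral_le_of_le_one hn hp hp'.ne hθ hθ1 hω hv hf hg.1.1 hg.2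
  · have hq1 : 1 ≤ θ.conjExponent.toReal := by
      rw [← ENNReal.toReal_one]
      exact ENNReal.toReal_mono (conjExponent_ne_top hθ1) (by simp [ENNReal.conjExponent])
    have hq0 : 0 < θ.conjExponent.toReal := zero_lt_one.trans_le hq1
    obtain ⟨C, hC, hupper⟩ := exists_lintegral_le_tailMeasure hn hp hp'.ne hθ hθ1 hω hv hq0
    -- The atom of Λ at 0 yields the quotient term, since B(0,0) is empty.
    have hsplit : ∀ f : RSpace n → EReal,
        ∫⁻ t, dualNorm p v (Metric.ball 0 t)ᶜ f ^ θ.conjExponent.toReal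
          ∂(tailMeasure hθ hω hq0) =
        ∫⁻ t in Ioi (0 : ℝ), dualNorm p v (Metric.ball 0 t)ᶜ f ^ θ.conjExponent.toReal
          ∂(stieltjesMeasure hω) +
        (dualNorm p v univ f / wNorm θ 1 (Ioi (0 : ℝ)) ω) ^ θ.conjExponent.toReal := fun f => by
      rw [lintegral_tailMeasure hθ hω hq0
        ((dualNorm_compl_ball_antitone p v f).measurable.pow_const _), stieltjesMeasure_eq hθ hω hq0,
        Metric.ball_zero, compl_empty, ← tailNorm_zero, div_eq_mul_inv,
        ENNReal.mul_rpow_of_nonneg _ _ hq0.le, ENNReal.inv_rpow, ← ENNReal.rpow_neg,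
        mul_comm (_ ^ (-_))]
    set q := θ.conjExponent.toReal with hq
    set r : ℝ≥0∞ := 2 ^ (-q⁻¹) with hr
    have hr1 : r < 1 :=
      ENNReal.rpow_lt_one_of_one_lt_of_neg ENNReal.one_lt_two (by simpa using hq0)
    set κ := 2 * (1 - r)⁻¹ with hκ
    have hκt : κ ≠ ∞ :=
      ENNReal.mul_ne_top (by norm_num) (ENNReal.inv_ne_top.2 (tsub_pos_of_lt hr1).ne')
    have hbt : 2 * κ + 1 ≠ ∞ := by simp [hκt, ENNReal.mul_eq_top]
    -- The Stieltjes term is at most 2κ times the associate norm and the quotient at most once that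
    -- norm.
    refine ⟨((2 * κ + 1).toNNReal)⁻¹, C, ?_, hC, fun f hf => ⟨?_, ?_⟩⟩
    · rw [inv_pos]
      exact ENNReal.toNNReal_pos (by simp) hbt
    · set M := associateNorm (LocalMorrey n p θ ω v) (morreyNorm p θ ω v) f with hM
      have hlow := lintegral_dualNorm_le_associateNorm (n := n) hp hp'.ne hθ1 hθ hω hv hf hq0 hq1
      have h1 : (∫⁻ t in Ioi (0 : ℝ), dualNorm p v (Metric.ball 0 t)ᶜ f ^ q
          ∂(stieltjesMeasure hω)) ^ (1 / q) ≤ 2 * κ * M := by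
        rw [one_div, ENNReal.rpow_inv_le_iff hq0]
        calc _ ≤ _ := le_self_add
          _ ≤ 2 * (κ * M) ^ q := (hsplit f).symm.le.trans hlow
          _ ≤ 2 ^ q * (κ * M) ^ q := by
              gcongr
              nth_rewrite 1 [← ENNReal.rpow_one 2]
              exact ENNReal.rpow_le_rpow_of_exponent_le (by norm_num) hq1
          _ = (2 * κ * M) ^ q := by rw [← ENNReal.mul_rpow_of_nonneg _ _ hq0.le, mul_assoc 2 κ M]
      have h2 : dualNorm p v univ f / wNorm θ 1 (Ioi (0 : ℝ)) ω ≤ M := by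
        have := dualNorm_mul_inv_le_associateNorm (n := n) hp hp'.ne hθ hω hv hf 0
        rwa [Metric.ball_zero, compl_empty, tailNorm_zero, ← div_eq_mul_inv] at this
      calc _ ≤ (((2 * κ + 1).toNNReal)⁻¹ : ℝ≥0) * (2 * κ * M + M) := by gcongr
        _ = (2 * κ + 1)⁻¹ * ((2 * κ + 1) * M) := by
            rw [ENNReal.coe_inv (ENNReal.toNNReal_pos (by simp) hbt).ne',
              ENNReal.coe_toNNReal hbt, add_mul, one_mul]
        _ = M := by rw [← mul_assoc, ENNReal.inv_mul_cancel (by simp) hbt, one_mul]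
        _ ≤ M := le_rfl
    · refine iSup₂_le fun g hg => (hupper f g hf hg.1.1 hg.2).trans ?_
      gcongr
      rw [hsplit f]
      -- Subadditivity of x ↦ x^{1/θ'}, valid because θ' ≥ 1, separates the two terms.
      refine (ENNReal.rpow_add_le_add_rpow _ _ (by positivity)
        (by rw [one_div]; exact inv_le_one_of_one_le₀ hq1)).trans ?_
      rw [one_div, ENNReal.rpow_rpow_inv hq0.ne']
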